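/- **Conventions.** A finite relational signature is a finite set of relation symbols, each with a positive arity; all structures are finite, and all classes of structures are closed under isomorphism. A class $\mathcal C$ of $\sigma$-structures is *local* if there is a positive integer $N$ such that a $\sigma$-structure $\mathbb A$ belongs to $\mathcal C$ if and only if every induced substructure of $\mathbb A$ with at most $N$ vertices belongs to $\mathcal C$. A *concrete functor* $F\colon\mathcal C\to\mathcal D$ between classes of structures, seen as categories whose morphisms are embeddings, is a functor with $F(f)=f$ (as a function) for every embedding $f$; thus $F$ preserves vertex sets and embeddings. It is *surjective* if every structure in $\mathcal D$ equals $F(\mathbb C)$ for some $\mathbb C\in\mathcal C$. A class $\mathcal D$ of $\tau$-structures, $\tau$ a finite relational signature, is *pseudo-local* if there are a finite relational signature $\sigma$, a local class $\mathcal C$ of $\sigma$-structures and a surjective concrete functor $F\colon\mathcal C\to\mathcal D$. A structure with vertex set $\{0,\dots,n-1\}$ is encoded as the binary string that consists of $1^n0$ followed by, for each relation symbol of arity $k$ (in a fixed order), the table of the $n^k$ truth values of its interpretation. The class $\mathcal D$ is identified with the language $L_{\mathcal D}\subseteq\{0,1\}^*$ of the encodings of its members. **Proposition.** Every pseudo-local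 class belongs to NP: if $\mathcal D$ is pseudo-local, then $L_{\mathcal D}\in\mathrm{NP}$. Moreover, whenever $\sigma$ is a finite relational signature, $\mathcal C$ is a local class of $\sigma$-structures and $F\colon\mathcal C\to\mathcal D$ is a surjective concrete functor, the structures in $\mathcal C$ that $F$ maps onto the input serve as certificates. That is, the relation $$\{(x,y) : x \text{ encodes } F(\mathbb C) \text{ and } y \text{ encodes } \mathbb C \text{ for some } \mathbb C\in\mathcal C\}$$ on binary strings is decidable in polynomial time by a Turing machine, and there is a polynomial $p$ such that, for every string $x$, $x\in L_{\mathcal D}$ if and only if there is a string $y$ with $|y|\le p(|x|)$ such that $(x,y)$ belongs to this relation. -/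

import Mathlib

namespace PseudoLocal

/-! ## Finite relational signatures, classes of finite structures -/

/-- A finite relational signature: a first-order language without function symbols, with finitely
many relation symbols, all of positive arity. -/
structure IsFiniteSignature (L : FirstOrder.Language.{0, 0}) : Prop where
  relational : L.IsRelational
  finite_symbols : Finite (Σ k, L.Relations k)
  arity_pos : IsEmpty (L.Relations 0)

/-- A class (property) of finite `L`-structures, closed under isomorphism. -/
structure StructureClass (L : FirstOrder.Language.{0, 0}) where
  /-- `C.Mem A`: the structure `A` with (finite) vertex set `V` belongs to the class `C`. -/
  Mem : ∀ {V : Type} [Finite V], L.Structure V → Prop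
  mem_of_equiv : ∀ {V W : Type} [Finite V] [Finite W] (A : L.Structure V) (B : L.Structure W),
    Nonempty (@FirstOrder.Language.Equiv L V W A B) → Mem A → Mem B

/-- `C` is a local class: for some positive integer `N`, a structure belongs to `C` if and only if
each of its (induced) substructures with at most `N` vertices does. Such a class is automatically
hereditary, that is, closed under embeddings. -/
def StructureClass.IsLocal {L : FirstOrder.Language.{0, 0}} (C : StructureClass L) : Prop :=
  ∃ N : ℕ, 0 < N ∧ ∀ {V : Type} [Finite V] (A : L.Structure V),
    C.Mem A ↔ ∀ S : L.Substructure V, Nat.card S ≤ N →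
      C.Mem (FirstOrder.Language.Substructure.inducedStructure (S := S))

/-! ## Concrete functors and pseudo-local classes -/

/-- A concrete functor between two classes of structures, regarded as categories whose morphisms
are the embeddings: `F f = f` as a function, for every embedding `f`. Since this includes the
identity maps, `F A` has the same vertex set as `A`; functoriality is automatic. -/
structure ConcreteFunctor {σ τ : FirstOrder.Language.{0, 0}}
    (C : StructureClass σ) (D : StructureClass τ) where
  obj : ∀ {V : Type} [Finite V] (A : σ.Structure V), C.Mem A → τ.Structure V
  obj_mem : ∀ {V : Type} [Finite V] (A : σ.Structure V) (hA : C.Mem A), D.Mem (obj A hA)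
  map : ∀ {V W : Type} [Finite V] [Finite W] (A : σ.Structure V) (B : σ.Structure W)
    (hA : C.Mem A) (hB : C.Mem B) (f : @FirstOrder.Language.Embedding σ V W A B),
    ∃ g : @FirstOrder.Language.Embedding τ V W (obj A hA) (obj B hB), (g : V → W) = f

/-- `F` is surjective: every structure in `D` is the image of a structure in `C`. -/
def ConcreteFunctor.IsSurjective {σ τ : FirstOrder.Language.{0, 0}}
    {C : StructureClass σ} {D : StructureClass τ} (F : ConcreteFunctor C D) : Prop :=
  ∀ {V : Type} [Finite V] (B : τ.Structure V), D.Mem B →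
    ∃ (A : σ.Structure V) (hA : C.Mem A), F.obj A hA = B

/-- `D` is pseudo-local: it is the image of a local class of `σ`-structures, for some finite
relational signature `σ`, under a concrete functor. -/
def StructureClass.IsPseudoLocal {τ : FirstOrder.Language.{0, 0}} (D : StructureClass τ) : Prop :=
  ∃ (σ : FirstOrder.Language.{0, 0}) (C : StructureClass σ) (F : ConcreteFunctor C D),
    IsFiniteSignature σ ∧ C.IsLocal ∧ F.IsSurjective

/-! ## Structures as binary strings -/

/-- The encoding of a structure with vertex set `{0, …, n-1}`: first `n` in unary, then, for each
relation symbol in the order given by the enumeration `e`, the table of truth values of the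
relation, where the tuple `t` of length `r` has position `∑ i, t i * n ^ i` in a table of
`n ^ r` bits. -/
noncomputable def encodeStructure {L : FirstOrder.Language.{0, 0}} {s : ℕ}
    (e : Fin s ≃ Σ k, L.Relations k) {n : ℕ} (A : L.Structure (Fin n)) : List Bool :=
  open Classical in
  List.replicate n true ++ false :: (List.finRange s).flatMap fun i =>
    List.ofFn fun j : Fin (n ^ (e i).1) => decide (A.RelMap (e i).2 (finFunctionFinEquiv.symm j))

/-- The membership problem of a class of structures, as a formal language. -/
def StructureClass.language {L : FirstOrder.Language.{0, 0}} {s : ℕ}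
    (e : Fin s ≃ Σ k, L.Relations k) (C : StructureClass L) : _root_.Language Bool :=
  {x | ∃ (n : ℕ) (A : L.Structure (Fin n)), C.Mem A ∧ encodeStructure e A = x}

/-! ## The class NP -/

/-- A pair of binary strings, written on one tape with a separator `none` between them. -/
def encodePair (p : List Bool × List Bool) : List (Option Bool) :=
  p.1.map some ++ none :: p.2.map some

/-- A binary relation on strings that a Turing machine decides in polynomial time. -/
def IsPolyTimeRelation (R : List Bool → List Bool → Prop) : Prop :=
  ∃ f : List Bool × List Bool → Bool,
    Nonempty (Turing.TM2ComputableInPolyTime encodePair Computability.encodeBool f) ∧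
      ∀ x y, f (x, y) = true ↔ R x y

/-- `R` is a polynomial-time certification of `X`: it is decidable in polynomial time, and `X` is
the set of strings `x` with a certificate `y`, of length polynomial in that of `x`. -/
def IsCertification (R : List Bool → List Bool → Prop) (X : _root_.Language Bool) : Prop :=
  IsPolyTimeRelation R ∧
    ∃ p : Polynomial ℕ, ∀ x, x ∈ X ↔ ∃ y : List Bool, y.length ≤ p.eval x.length ∧ R x y

/-- The complexity class NP. -/
def NP : Set (_root_.Language Bool) :=
  {X | ∃ R, IsCertification R X}

/-- `F.certificate eσ eτ x y`: the string `y` encodes a structure in the domain of `F`, and `x`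
encodes its image under `F`. -/
def ConcreteFunctor.certificate {σ τ : FirstOrder.Language.{0, 0}}
    {C : StructureClass σ} {D : StructureClass τ} (F : ConcreteFunctor C D) {r s : ℕ}
    (eσ : Fin r ≃ Σ k, σ.Relations k) (eτ : Fin s ≃ Σ k, τ.Relations k) (x y : List Bool) : Prop :=
  ∃ (n : ℕ) (A : σ.Structure (Fin n)) (hA : C.Mem A),
    encodeStructure eσ A = y ∧ encodeStructure eτ (F.obj A hA) = x

end PseudoLocal

/-! The mathematical core is that a concrete functor commutes with passing to induced substructures.
The inclusion of a vertex set into `A` is an embedding, and `F` keeps it as a map, so `F` of the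
induced substructure is the substructure that `F A` induces (`ConcreteFunctor.obj_pullback`). Hence
"`A` lies in `C` and `F A = A'`" can be tested on boundedly many vertices at a time: membership
because `C` is local, equality because a tuple in a relation of `A'` meets at most as many vertices
as its arity (`ConcreteFunctor.obj_eq_iff`). For a fixed bound `B` on the number of vertices, the
correct answers form a finite table that can be built into a machine, even though nothing is assumed
about the computability of `C` and `F`. There are polynomially many sets of at most `B` vertices. A
preimage of the input has the same `n` vertices, so its encoding has length polynomial in `n`, and
`n` is at most the input length.

The remaining work is an actual polynomial-time machine. Programs with unary counters and bounded
loops are compiled into stack machines with a time bound (`stepsLE_code`,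
`computableInPolyTime_of_loopProg`). One such program checks the shape of the tape, enumerates
increasing tuples by their gaps, and consults the finite table (`Ctr.checkAll_spec`).
`hasFormat_pairFormat` and `good_iff` translate what it checks back into statements about
structures. -/

namespace PseudoLocal

open Turing Function

/-! ## Loop programs -/

/-- Programs of a loop language with a read-only tape, unary counters indexed by `V` and a finite
memory `S`. The program `loop v t p` runs `p` once for every unit of the counter `v`; during the
`i`-th run the counter `t` holds `i` and the counter `v` what remains to be done. -/
inductive LoopProg (V S : Type)
  | act (f : S → S)
  | read (f : S → Option (Option Bool) → S)
  | rewind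
  | seq (p q : LoopProg V S)
  | loop (v t : V) (p : LoopProg V S)

/-- Iterate a function that depends on the number of iterations done before. -/
def iterIdx {X : Type} (f : ℕ → X → X) : ℕ → X → X
  | 0, x => x
  | k + 1, x => f k (iterIdx f k x)

namespace LoopProg

variable {V S : Type}

/-- The counters after `i` units have been moved from `v` to `t`, where a unit in addition has been
taken off `v` if `d = 1`. -/
def shiftEnv [DecidableEq V] (env : V → ℕ) (v t : V) (i d : ℕ) : V → ℕ :=
  update (update env t i) v (env v - i - d)

/-- The semantics of a program on the tape `w`: it changes the memory and the position on the tape,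
and leaves the counters as they were. -/
def eval [DecidableEq V] (w : List (Option Bool)) : LoopProg V S → (V → ℕ) → S × ℕ → S × ℕ
  | act f, _, x => (f x.1, x.2)
  | read f, _, x => (f x.1 w[x.2]?, x.2 + 1)
  | rewind, _, x => (x.1, 0)
  | seq p q, env, x => q.eval w env (p.eval w env x)
  | loop v t p, env, x => iterIdx (fun i => p.eval w (shiftEnv env v t i 1)) (env v) x

/-- The condition that each loop starts with an empty target counter. -/
def Ok [DecidableEq V] : LoopProg V S → (V → ℕ) → Prop
  | seq p q, env => p.Ok env ∧ q.Ok env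
  | loop v t p, env => v ≠ t ∧ env t = 0 ∧ ∀ i < env v, p.Ok (shiftEnv env v t i 1)
  | _, _ => True

/-- A bound for the running time, in terms of a common bound for the length of the tape and the
counters. -/
noncomputable def bound : LoopProg V S → Polynomial ℕ
  | act _ => 1
  | read _ => 1
  | rewind => Polynomial.X + 1
  | seq p q => p.bound + q.bound
  | loop _ _ p => Polynomial.X * (p.bound + 2) + 1 + (Polynomial.X + 1)

/-! ## Compilation into stack machines -/

/-- The labels of the compiled program. -/
def Lab : LoopProg V S → Type
  | act _ => Unit
  | read _ => Unit
  | rewind => Unit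
  | seq p q => p.Lab ⊕ q.Lab
  | loop _ _ p => Fin 3 ⊕ p.Lab

theorem finite_lab (p : LoopProg V S) : Finite p.Lab := by
  induction p with
  | act _ => exact inferInstanceAs (Finite Unit)
  | read _ => exact inferInstanceAs (Finite Unit)
  | rewind => exact inferInstanceAs (Finite Unit)
  | seq p q hp hq => exact inferInstanceAs (Finite (p.Lab ⊕ q.Lab))
  | loop v t p hp => exact inferInstanceAs (Finite (Fin 3 ⊕ p.Lab))

/-- The label at which the compiled program starts. -/
def entry : (p : LoopProg V S) → p.Lab
  | act _ => ()
  | read _ => ()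
  | rewind => ()
  | seq p _ => Sum.inl p.entry
  | loop _ _ _ => Sum.inl 0

end LoopProg

/-- The stacks: the tape to the right and to the left of the head, the output, the counters. -/
inductive Stk (V : Type)
  | inp
  | back
  | out
  | var (v : V)
  deriving DecidableEq, Fintype

/-- The alphabets of the stacks. -/
abbrev Stk.Alph {V : Type} : Stk V → Type
  | .out => Bool
  | _ => Option Bool

namespace LoopProg

open TM2.Stmt

variable {V S : Type}

/-- Store the symbol that was popped. -/
def store (x : S × Option (Option Bool)) (c : Option (Option Bool)) : S × Option (Option Bool) :=
  (x.1, c)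

/-- Forget the symbol that was popped. -/
def reset (x : S × Option (Option Bool)) : S × Option (Option Bool) :=
  (x.1, none)

/-- The code of a program, whose labels are embedded into `Λ`, and which leaves to `exit`. -/
def code {Λ : Type} : (p : LoopProg V S) → (p.Lab → Λ) → Λ → p.Lab →
    TM2.Stmt (Stk.Alph (V := V)) Λ (S × Option (Option Bool))
  | act f, _, exit, _ => load (fun x => (f x.1, none)) (goto fun _ => exit)
  | read f, _, exit, _ =>
    pop .inp (fun x c => (f x.1 c, c)) <| branch (fun x => x.2.isSome)
      (push .back (fun x => x.2.getD none) <| load reset <| goto fun _ => exit)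
      (goto fun _ => exit)
  | rewind, emb, exit, _ =>
    pop .back store <| branch (fun x => x.2.isSome)
      (push .inp (fun x => x.2.getD none) <| load reset <| goto fun _ => emb ())
      (goto fun _ => exit)
  | seq p q, emb, exit, l =>
    match l with
    | .inl l => p.code (fun l => emb (.inl l)) (emb (.inr q.entry)) l
    | .inr l => q.code (fun l => emb (.inr l)) exit l
  -- Label 0 takes a unit off `v` and enters the body, label 2 credits that unit to `t` afterwards,
  -- and label 1 finally moves all units from `t` back to `v`.
  | loop v t p, emb, exit, l =>
    match l with
    | .inl 0 =>
      pop (.var v) store <| branch (fun x => x.2.isSome)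
        (load reset <| goto fun _ => emb (.inr p.entry)) (goto fun _ => emb (.inl 1))
    | .inl 1 =>
      pop (.var t) store <| branch (fun x => x.2.isSome)
        (push (.var v) (fun _ => (none : Option Bool)) <| load reset <|
          goto fun _ => emb (.inl 1))
        (goto fun _ => exit)
    | .inl 2 => push (.var t) (fun _ => (none : Option Bool)) <| goto fun _ => emb (.inl 0)
    | .inr l => p.code (fun l => emb (.inr l)) (emb (.inl 2)) l

end LoopProg

/-- The contents of the stacks, with the head at position `i` of the tape `w`. -/
def contents {V : Type} (w : List (Option Bool)) (i : ℕ) (env : V → ℕ) :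
    (k : Stk V) → List k.Alph
  | .inp => w.drop i
  | .back => (w.take i).reverse
  | .out => []
  | .var v => List.replicate (env v) (none : Option Bool)

/-- A configuration in which no symbol is stored. -/
def mkCfg {V S Λ : Type} (w : List (Option Bool)) (l : Λ) (x : S × ℕ) (env : V → ℕ) :
    TM2.Cfg (Stk.Alph (V := V)) Λ (S × Option (Option Bool)) :=
  ⟨some l, (x.1, none), contents w x.2 env⟩

/-- `f` leads from `a` to `b` in at most `c` steps. -/
def StepsLE {X : Type} (f : X → Option X) (a b : X) (c : ℕ) : Prop :=
  ∃ k ≤ c, (flip bind f)^[k] (some a) = some b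

namespace StepsLE

variable {X : Type} {f : X → Option X} {a b d : X} {c c' : ℕ}

theorem refl (a : X) (c : ℕ) : StepsLE f a a c :=
  ⟨0, Nat.zero_le c, rfl⟩

theorem single (h : f a = some b) : StepsLE f a b 1 :=
  ⟨1, le_rfl, h⟩

theorem mono (h : StepsLE f a b c) (hc : c ≤ c') : StepsLE f a b c' :=
  let ⟨k, hk, e⟩ := h
  ⟨k, hk.trans hc, e⟩

theorem trans (h : StepsLE f a b c) (h' : StepsLE f b d c') : StepsLE f a d (c + c') := by
  obtain ⟨k, hk, e⟩ := h
  obtain ⟨k', hk', e'⟩ := h'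
  exact ⟨k' + k, by omega, by rw [iterate_add_apply, e, e']⟩

end StepsLE

/-! ### Simulation of the semantics by the compiled code -/

section Simulation

variable {V S Λ : Type} {w : List (Option Bool)}
  {M : Λ → TM2.Stmt (Stk.Alph (V := V)) Λ (S × Option (Option Bool))}

/-- In the semantics each `read` advances the position, even past the end of the tape, where the
machine stands still. The stacks cannot tell these positions apart. -/
theorem contents_min (i : ℕ) (env : V → ℕ) :
    contents w (min i w.length) env = contents w i env := by
  funext k
  rcases k with _ | _ | _ | u
  · rcases le_total i w.length with h | h <;> simp [contents, h]
  · simp [contents]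
  · rfl
  · rfl

variable [DecidableEq V]

theorem update_contents_var (i : ℕ) (env : V → ℕ) (v : V) (k : ℕ) (l : List (Option Bool))
    (h : l = List.replicate k none) :
    update (contents w i env) (.var v) l = contents w i (update env v k) := by
  subst h
  funext j
  rcases j with _ | _ | _ | u
  · rfl
  · rfl
  · rfl
  · by_cases h : u = v
    · subst h; simp [contents]
    · have : Stk.var u ≠ Stk.var v := fun e => h (Stk.var.inj e)
      simp [contents, update_of_ne this, update_of_ne h]

theorem update_contents_tape (i j : ℕ) (env : V → ℕ) :
    update (update (contents w i env) .inp (w.drop j)) .back (w.take j).reverse =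
      contents w j env := by
  funext k
  rcases k with _ | _ | _ | u <;> simp [contents, update]

theorem update_contents_tape' (i j : ℕ) (env : V → ℕ) :
    update (update (contents w i env) .back (w.take j).reverse) .inp (w.drop j) =
      contents w j env := by
  rw [update_comm (by simp), update_contents_tape]

theorem stepsLE_rewind (l : Λ) (exit : Λ) (hM : M l = LoopProg.code .rewind (fun _ => l) exit ())
    (x : S) (env : V → ℕ) (i : ℕ) (hi : i ≤ w.length) :
    StepsLE (TM2.step M) (mkCfg w l (x, i) env) (mkCfg w exit (x, 0) env) (i + 1) := by
  induction i with
  | zero =>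
    apply StepsLE.single
    have : update (contents w 0 env) .back [] = contents w 0 env := update_eq_self_iff.2 rfl
    simp [mkCfg, hM, LoopProg.code, LoopProg.store, contents] at this ⊢
  | succ i ih =>
    refine (StepsLE.trans (StepsLE.single (b := mkCfg w l (x, i) env) ?_) (ih (by omega))).mono
      (by omega)
    have h := update_contents_tape' (w := w) (i + 1) i env
    have hw' : (w.take (i + 1)).reverse = w[i] :: (w.take i).reverse := by
      rw [List.take_succ_eq_append_getElem (by omega)]; simp
    simp [mkCfg, hM, LoopProg.code, LoopProg.store, LoopProg.reset]
    rw [← h]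
    simp [contents, hw']

theorem stepsLE_read (f : S → Option (Option Bool) → S) (l : Λ) (exit : Λ)
    (hM : M l = LoopProg.code (.read f) (fun _ => l) exit ()) (x : S × ℕ) (env : V → ℕ) :
    StepsLE (TM2.step M) (mkCfg w l x env)
      (mkCfg w exit (f x.1 w[x.2]?, x.2 + 1) env) 1 := by
  apply StepsLE.single
  have h := update_contents_tape (w := w) x.2 (x.2 + 1) env
  rcases lt_or_ge x.2 w.length with hx | hx
  · have hw : w.drop x.2 = w[x.2] :: w.drop (x.2 + 1) := List.drop_eq_getElem_cons (by omega)
    have hw' : (w.take (x.2 + 1)).reverse = w[x.2] :: (w.take x.2).reverse := by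
      rw [List.take_succ_eq_append_getElem (by omega)]; simp
    simp [mkCfg, hM, LoopProg.code, LoopProg.reset]
    rw [← h]
    simp [contents, hw', hx]
  -- Past the end the pop yields `none` and nothing is pushed, so the stacks stay as they are.
  · have h1 : w.drop x.2 = [] := List.drop_eq_nil_of_le hx
    have h2 : contents w (x.2 + 1) env = contents w x.2 env := by
      rw [← contents_min, ← contents_min (i := x.2)]; congr 1; omega
    have : update (contents w x.2 env) .inp [] = contents w x.2 env :=
      update_eq_self_iff.2 h1.symm
    simp [mkCfg, hM, LoopProg.code, contents, h1, hx, h2] at this ⊢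

theorem step_pop (l : Λ) (v : V) (q₁ q₂ : TM2.Stmt (Stk.Alph (V := V)) Λ (S × Option (Option Bool)))
    (hM : M l = .pop (.var v) LoopProg.store (.branch (fun x => x.2.isSome) q₁ q₂))
    (x : S × ℕ) (env : V → ℕ) :
    TM2.step M (mkCfg w l x env) =
      some (if env v = 0 then TM2.stepAux q₂ (x.1, none) (contents w x.2 env)
        else TM2.stepAux q₁ (x.1, some none) (contents w x.2 (update env v (env v - 1)))) := by
  rcases h : env v with _ | k
  · have : update (contents w x.2 env) (.var v) [] = contents w x.2 env :=
      update_eq_self_iff.2 (by simp [contents, h])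
    simp [mkCfg, hM, LoopProg.store, contents, h]
    rw [this]
  · have := update_contents_var (w := w) x.2 env v k _ rfl
    simp [mkCfg, hM, LoopProg.store, contents, h, List.replicate_succ]
    rw [this]

theorem stepAux_push_var (q : TM2.Stmt (Stk.Alph (V := V)) Λ (S × Option (Option Bool)))
    (v : V) (s : S × Option (Option Bool)) (i : ℕ) (env : V → ℕ) :
    TM2.stepAux (.push (.var v) (fun _ => (none : Option Bool)) q) s (contents w i env) =
      TM2.stepAux q s (contents w i (update env v (env v + 1))) := by
  rw [← update_contents_var i env v (env v + 1) _ rfl]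
  simp [contents, List.replicate_succ]

theorem shiftEnv_le {env : V → ℕ} {v t : V} {i d L : ℕ} (hi : i ≤ env v) (h : ∀ u, env u ≤ L)
    (u : V) : LoopProg.shiftEnv env v t i d u ≤ L := by
  have := h v
  have := h u
  unfold LoopProg.shiftEnv
  by_cases hv : u = v
  · subst hv; simp; omega
  · by_cases ht : u = t
    · subst ht; simp [hv]; omega
    · simp [hv, ht]; omega

/-- The compiled program simulates the semantics. -/
theorem stepsLE_code (p : LoopProg V S) (emb : p.Lab → Λ) (exit : Λ)
    (hM : ∀ l, M (emb l) = p.code emb exit l) (x : S × ℕ) (env : V → ℕ) (hok : p.Ok env)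
    (henv : ∀ v, env v ≤ w.length) :
    StepsLE (TM2.step M) (mkCfg w (emb p.entry) x env) (mkCfg w exit (p.eval w env x) env)
      (p.bound.eval w.length) := by
  induction p generalizing exit x env with
  | act f =>
    have h := hM ()
    refine (StepsLE.single ?_).mono (by simp [LoopProg.bound])
    simp [LoopProg.entry, mkCfg, h, LoopProg.code, LoopProg.eval]
  | read f =>
    exact (stepsLE_read f _ exit (hM ()) x env).mono (by simp [LoopProg.bound])
  | rewind =>
    -- Cutting the position off at the end of the tape makes the cost depend on the tape only,
    -- however far the virtual head has moved.
    have h := stepsLE_rewind (M := M) (w := w) _ exit (hM ()) x.1 env (min x.2 w.length)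
      (min_le_right _ _)
    rw [show mkCfg w (emb ()) (x.1, min x.2 w.length) env = mkCfg w (emb ()) x env by
      simp [mkCfg, contents_min]] at h
    refine h.mono ?_
    simp [LoopProg.bound]
  | seq p q hp hq =>
    have h1 := hp (fun l => emb (.inl l)) (emb (.inr q.entry)) (fun l => hM (.inl l)) x env hok.1
      henv
    have h2 := hq (fun l => emb (.inr l)) exit (fun l => hM (.inr l)) (p.eval w env x) env hok.2
      henv
    exact (h1.trans h2).mono (by simp [LoopProg.bound])
  | loop v t p hp =>
    obtain ⟨hvt, ht, hbody⟩ := hok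
    have h0 := fun y env' => step_pop (w := w) (emb (.inl 0)) v _ _ (hM (.inl 0)) y env'
    have h1 := fun y env' => step_pop (w := w) (emb (.inl 1)) t _ _ (hM (.inl 1)) y env'
    have h2 := hM (.inl 2)
    simp only [LoopProg.code] at h2
    set B := p.bound.eval w.length with hB
    set f := fun i => p.eval w (LoopProg.shiftEnv env v t i 1) with hf
    have hstart : LoopProg.shiftEnv env v t 0 0 = env := by
      funext u
      by_cases hv : u = v
      · subst hv; simp [LoopProg.shiftEnv]
      · by_cases hu : u = t
        · subst hu; simp [LoopProg.shiftEnv, hv, ht]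
        · simp [LoopProg.shiftEnv, hv, hu]
    -- Invariant of the forward phase. A round costs `B` for the body and 2 for the pop before and
    -- the push after it.
    have hfwd : ∀ i ≤ env v, StepsLE (TM2.step M) (mkCfg w (emb (.inl 0)) x env)
        (mkCfg w (emb (.inl 0)) (iterIdx f i x) (LoopProg.shiftEnv env v t i 0))
        (i * (B + 2)) := by
      intro i
      induction i with
      | zero => intro _; rw [hstart]; exact StepsLE.refl _ _
      | succ i ih =>
        intro hi
        have e1 : TM2.step M
            (mkCfg w (emb (.inl 0)) (iterIdx f i x) (LoopProg.shiftEnv env v t i 0)) =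
            some (mkCfg w (emb (.inr p.entry)) (iterIdx f i x)
              (LoopProg.shiftEnv env v t i 1)) := by
          rw [h0]
          have : env v - i ≠ 0 := by omega
          simp [LoopProg.shiftEnv, this, LoopProg.reset, mkCfg]
        have e2 := hp (fun l => emb (.inr l)) (emb (.inl 2)) (fun l => hM (.inr l))
          (iterIdx f i x) _ (hbody i (by omega)) (shiftEnv_le (by omega) henv)
        have e3 : TM2.step M
            (mkCfg w (emb (.inl 2)) (iterIdx f (i + 1) x) (LoopProg.shiftEnv env v t i 1)) =
            some (mkCfg w (emb (.inl 0)) (iterIdx f (i + 1) x)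
              (LoopProg.shiftEnv env v t (i + 1) 0)) := by
          have : update (LoopProg.shiftEnv env v t i 1) t (i + 1) =
              LoopProg.shiftEnv env v t (i + 1) 0 := by
            rw [LoopProg.shiftEnv, LoopProg.shiftEnv, update_comm hvt, update_idem]
            rfl
          simp only [mkCfg, TM2.step, h2, stepAux_push_var]
          rw [← this]
          simp [LoopProg.shiftEnv, hvt.symm]
        refine ((((ih (by omega)).trans (.single e1)).trans e2).trans (.single e3)).mono ?_
        apply le_of_eq
        ring
    have hmid : TM2.step M (mkCfg w (emb (.inl 0)) (iterIdx f (env v) x)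
        (LoopProg.shiftEnv env v t (env v) 0)) = some (mkCfg w (emb (.inl 1))
          (iterIdx f (env v) x) (LoopProg.shiftEnv env v t (env v) 0)) := by
      rw [h0]
      simp [LoopProg.shiftEnv, mkCfg]
    -- The units in `t` return to `v` one per step; one more step finds `t` empty.
    have hback : ∀ i ≤ env v, StepsLE (TM2.step M) (mkCfg w (emb (.inl 1)) (iterIdx f (env v) x)
        (LoopProg.shiftEnv env v t i 0)) (mkCfg w exit (iterIdx f (env v) x) env) (i + 1) := by
      intro i
      induction i with
      | zero =>
        intro _
        apply StepsLE.single
        rw [h1, hstart]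
        simp [ht, mkCfg]
      | succ i ih =>
        intro hi
        refine (StepsLE.trans (StepsLE.single
          (b := mkCfg w (emb (.inl 1)) (iterIdx f (env v) x) (LoopProg.shiftEnv env v t i 0)) ?_)
          (ih (by omega))).mono (by omega)
        have : env v - (i + 1) + 1 = env v - i := by omega
        rw [h1, if_neg (by simp [LoopProg.shiftEnv, hvt.symm]), stepAux_push_var]
        simp [LoopProg.shiftEnv, hvt.symm, hvt, mkCfg, LoopProg.reset, update_comm hvt, this]
    refine (((hfwd _ le_rfl).trans (.single hmid)).trans (hback _ le_rfl)).mono ?_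
    have h3 : env v * (B + 2) ≤ w.length * (B + 2) := Nat.mul_le_mul_right _ (henv v)
    have h4 := henv v
    simp only [LoopProg.bound, Polynomial.eval_add, Polynomial.eval_mul, Polynomial.eval_X,
      Polynomial.eval_one, Polynomial.eval_ofNat, ← hB]
    omega

end Simulation

/-! ## From loop programs to machines -/

/-- The number of symbols `some true` at the beginning of a tape. -/
def leadTrue (w : List (Option Bool)) : ℕ :=
  w.findIdx (· != some true)

/-- Push a unit on each of the given counters. -/
def pushAll {V Λ T : Type} (l : List V) (q : TM2.Stmt (Stk.Alph (V := V)) Λ T) :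
    TM2.Stmt (Stk.Alph (V := V)) Λ T :=
  l.foldr (fun v q => .push (.var v) (fun _ => (none : Option Bool)) q) q

/-- Pop each of the given stacks, and store whether one of them was nonempty. -/
def popAll {V Λ S : Type} (l : List (Stk V))
    (q : TM2.Stmt (Stk.Alph (V := V)) Λ (S × Option (Option Bool))) :
    TM2.Stmt (Stk.Alph (V := V)) Λ (S × Option (Option Bool)) :=
  l.foldr (fun k q => .pop k (fun x c => (x.1, if c.isSome then some none else x.2)) q) q

/-- The counters, with the value `n` for those in the list `l`. -/
def initEnv {V : Type} [DecidableEq V] (l : List V) (n : ℕ) (v : V) : ℕ :=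
  if v ∈ l then n else 0

section

variable {V S Λ : Type} [DecidableEq V] {w : List (Option Bool)}

theorem stepAux_pushAll (l : List V)
    (q : TM2.Stmt (Stk.Alph (V := V)) Λ (S × Option (Option Bool)))
    (s : S × Option (Option Bool)) (i : ℕ) (env : V → ℕ) :
    TM2.stepAux (pushAll l q) s (contents w i env) =
      TM2.stepAux q s (contents w i fun v => env v + l.count v) := by
  induction l generalizing env with
  | nil => rfl
  | cons a l ih =>
    rw [pushAll, List.foldr_cons, stepAux_push_var, ← pushAll, ih]
    congr 2
    funext v
    by_cases h : v = a
    · subst h; simp; omega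
    · simp [h, Ne.symm h]

theorem stepAux_popAll (l : List (Stk V)) (hl : l.Nodup)
    (q : TM2.Stmt (Stk.Alph (V := V)) Λ (S × Option (Option Bool)))
    (x : S × Option (Option Bool)) (T : (k : Stk V) → List k.Alph) :
    TM2.stepAux (popAll l q) x T =
      TM2.stepAux q (x.1, if ∀ k ∈ l, T k = [] then x.2 else some none)
        (fun k => if k ∈ l then (T k).tail else T k) := by
  induction l generalizing x T with
  | nil => simp [popAll]
  | cons a l ih =>
    obtain ⟨ha, hl⟩ := List.nodup_cons.1 hl
    rw [popAll, List.foldr_cons, TM2.stepAux, ← popAll, ih hl]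
    have hT : ∀ k ∈ l, update T a (T a).tail k = T k := fun k hk =>
      update_of_ne (by rintro rfl; exact ha hk) _ _
    congr 1
    · have : (∀ k ∈ l, update T a (T a).tail k = []) ↔ ∀ k ∈ l, T k = [] :=
        forall₂_congr fun k hk => by rw [hT k hk]
      simp only [this, List.forall_mem_cons]
      by_cases h1 : T a = []
      · simp [h1]
      · obtain ⟨b, m, hm⟩ := List.exists_cons_of_ne_nil h1
        simp [hm]
    · funext k
      by_cases hk : k = a
      · subst hk; simp [ha]
      · simp [hk]

/-- The code of the whole machine: `inl 0` reads the block of `some true` at the beginning of the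
tape into the counters `src`, then the program `p` is run, then `inl 1` clears all stacks and
writes the output. -/
noncomputable def fullCode [Fintype V] (p : LoopProg V S) (src : List V) (s₀ : S) (o : S → Bool) :
    Fin 2 ⊕ p.Lab →
      TM2.Stmt (Stk.Alph (V := V)) (Fin 2 ⊕ p.Lab) (S × Option (Option Bool))
  | .inl 0 =>
    .peek .inp LoopProg.store <| .branch (fun x => x.2 == some (some true))
      (.pop .inp (fun x _ => x) <| .push .back (fun _ => some true) <| pushAll src <|
        .load LoopProg.reset <| .goto fun _ => .inl 0)
      (.load LoopProg.reset <| .goto fun _ => .inr p.entry)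
  | .inl 1 =>
    popAll ((Finset.univ.erase Stk.out).toList) <| .branch (fun x => x.2.isSome)
      (.load LoopProg.reset <| .goto fun _ => .inl 1)
      (.push .out (fun x => o x.1) <| .load (fun _ => (s₀, none)) .halt)
  | .inr l => p.code .inr (.inl 1) l

variable [Fintype V] (p : LoopProg V S) (src : List V) (s₀ : S) (o : S → Bool)

/-- Each leading `some true` costs one step and adds a unit to every counter in `src`; one more step
detects the end of the block. The head is left behind the block. -/
theorem stepsLE_scan (hsrc : src.Nodup) :
    StepsLE (TM2.step (fullCode p src s₀ o)) (mkCfg w (.inl 0) (s₀, 0) (fun _ => 0))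
      (mkCfg w (.inr p.entry) (s₀, leadTrue w) (initEnv src (leadTrue w))) (w.length + 1) := by
  have hlen : leadTrue w ≤ w.length := List.findIdx_le_length
  have key : ∀ i ≤ leadTrue w,
      StepsLE (TM2.step (fullCode p src s₀ o)) (mkCfg w (.inl 0) (s₀, 0) (fun _ => 0))
        (mkCfg w (.inl 0) (s₀, i) (initEnv src i)) i := by
    intro i
    induction i with
    | zero =>
      intro _
      rw [show initEnv src 0 = fun _ => 0 by funext v; simp [initEnv]]
      exact StepsLE.refl _ _
    | succ i ih =>
      intro hi
      refine (ih (by omega)).trans (StepsLE.single ?_)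
      have hiw : i < w.length := by omega
      have hwi : w[i] = some true := by
        simpa using List.not_of_lt_findIdx (p := (· != some true)) (xs := w) (i := i) hi
      have hw' : (w.take (i + 1)).reverse = w[i] :: (w.take i).reverse := by
        rw [List.take_succ_eq_append_getElem (by omega)]; simp
      have henv : (fun v => initEnv src i v + src.count v) = initEnv src (i + 1) := by
        funext v
        by_cases h : v ∈ src <;> simp [initEnv, h, List.count_eq_one_of_mem, List.count_eq_zero_of_not_mem, hsrc]
      have h := update_contents_tape (w := w) i (i + 1) (initEnv src i)
      simp [hw', hwi] at h
      simp [mkCfg, fullCode, LoopProg.store, contents, hiw, hwi]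
      rw [h, stepAux_pushAll, henv]
      simp [LoopProg.reset]
  refine ((key _ le_rfl).trans (StepsLE.single ?_)).mono (by omega)
  have h : w[leadTrue w]? ≠ some (some true) := fun h => by
    obtain ⟨hl, h⟩ := List.getElem?_eq_some_iff.1 h
    have : (w[leadTrue w] != some true) = true :=
      List.findIdx_getElem (p := (· != some true)) (xs := w) (w := hl)
    rw [h] at this
    simp at this
  have h' : (w[leadTrue w]? == some (some true)) = false := by simpa using h
  simp [mkCfg, fullCode, LoopProg.store, contents, h', LoopProg.reset]

/-- A halting configuration must have empty stacks apart from the output, and the initial memory.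
All stacks are popped in parallel, so the number of rounds is governed by the height `B` of the
highest one. -/
theorem stepsLE_clean (s : S) (B : ℕ) (T : (k : Stk V) → List k.Alph) (hT : T .out = [])
    (hB : ∀ k, (T k).length ≤ B) :
    StepsLE (TM2.step (fullCode p src s₀ o)) ⟨some (.inl 1), (s, none), T⟩
      ⟨none, (s₀, none), update (fun _ => []) .out [o s]⟩ (B + 1) := by
  have hnd := (Finset.univ.erase (Stk.out : Stk V)).nodup_toList
  induction B generalizing T with
  | zero =>
    apply StepsLE.single
    have h0 : T = fun _ => [] := by
      funext k; exact List.eq_nil_of_length_eq_zero (Nat.le_zero.1 (hB k))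
    subst h0
    simp [fullCode, stepAux_popAll _ hnd]
  | succ B ih =>
    by_cases h : ∀ k, T k = []
    · refine StepsLE.mono (StepsLE.single ?_) (Nat.le_add_left _ _)
      have h0 : T = fun _ => [] := funext h
      subst h0
      simp [fullCode, stepAux_popAll _ hnd]
    · have h' : ¬ ∀ k, ¬ k = Stk.out → T k = [] := fun h1 => h fun k => by
        by_cases hk : k = Stk.out
        · subst hk; exact hT
        · exact h1 k hk
      refine (StepsLE.trans (StepsLE.single ?_) (ih (fun k => (T k).tail) (by simp [hT])
        fun k => by have := hB k; simp; omega)).mono (by omega)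
      simp [fullCode, stepAux_popAll _ hnd, h', LoopProg.reset]
      funext k
      by_cases hk : k = Stk.out
      · subst hk; simp [hT]
      · simp [hk]

end

/-- A function computed by a loop program is computable in polynomial time. -/
theorem computableInPolyTime_of_loopProg {V S α : Type} [DecidableEq V] [Fintype V] [Finite S]
    (p : LoopProg V S) (src : List V) (hsrc : src.Nodup) (s₀ : S) (o : S → Bool)
    (ea : α → List (Option Bool)) (g : α → Bool) (hok : ∀ n, p.Ok (initEnv src n))
    (hg : ∀ a, o (p.eval (ea a) (initEnv src (leadTrue (ea a))) (s₀, 0)).1 = g a) :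
    Nonempty (TM2ComputableInPolyTime ea Computability.encodeBool g) := by
  classical
  -- The scan of the leading block has moved the head, while `p` expects it at position 0.
  let P : LoopProg V S := .seq .rewind p
  have := P.finite_lab
  let := Fintype.ofFinite P.Lab
  let := Fintype.ofFinite S
  let tm : FinTM2 :=
    { K := Stk V
      k₀ := .inp
      k₁ := .out
      Γ := Stk.Alph
      Λ := Fin 2 ⊕ P.Lab
      main := .inl 0
      σ := S × Option (Option Bool)
      initialState := (s₀, none)
      Γk₀Fin := inferInstanceAs (Fintype (Option Bool))
      m := fullCode P src s₀ o }
  have key : ∀ a, StepsLE tm.step (initList tm (ea a)) (haltList tm [g a])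
      -- The three summands pay for the scan, the program and the final clearing of the stacks.
      ((Polynomial.X + 1 + P.bound + (Polynomial.X + 1)).eval (ea a).length) := by
    intro a
    set w := ea a
    have hlen : leadTrue w ≤ w.length := List.findIdx_le_length
    have henv : ∀ v, initEnv src (leadTrue w) v ≤ w.length := fun v => by
      unfold initEnv; split <;> omega
    have h1 := stepsLE_scan (w := w) P src s₀ o hsrc
    have h2 := stepsLE_code (M := fullCode P src s₀ o) (w := w) P .inr (.inl 1) (fun _ => rfl)
      (s₀, leadTrue w) (initEnv src (leadTrue w)) ⟨trivial, hok _⟩ henv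
    have h3 := stepsLE_clean P src s₀ o (P.eval w (initEnv src (leadTrue w)) (s₀, leadTrue w)).1
      w.length (contents w (P.eval w (initEnv src (leadTrue w)) (s₀, leadTrue w)).2
        (initEnv src (leadTrue w))) rfl (by
          rintro (_ | _ | _ | v)
          · simp [contents]
          · simp [contents]
          · simp [contents]
          · simpa [contents] using henv v)
    have h4 := (h1.trans h2).trans h3
    have e1 : initList tm w = mkCfg w (.inl 0) (s₀, 0) (fun _ => 0) := by
      refine congrArg (TM2.Cfg.mk _ _) (funext fun k => ?_)
      rcases k with _ | _ | _ | v <;> rfl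
    have e2 : haltList tm [g a] = ⟨none, (s₀, none), update (fun _ => []) .out
        [o (P.eval w (initEnv src (leadTrue w)) (s₀, leadTrue w)).1]⟩ := by
      have h5 : (P.eval w (initEnv src (leadTrue w)) (s₀, leadTrue w)) =
          p.eval w (initEnv src (leadTrue w)) (s₀, 0) := rfl
      rw [h5, hg]
      refine congrArg (TM2.Cfg.mk _ _) (funext fun k => ?_)
      rcases k with _ | _ | _ | v <;> rfl
    rw [e1, e2]
    refine StepsLE.mono h4 (le_of_eq ?_)
    simp
  refine ⟨{ tm := tm, inputAlphabet := Equiv.refl _, outputAlphabet := Equiv.refl _,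
            time := Polynomial.X + 1 + P.bound + (Polynomial.X + 1), outputsFun := fun a => ?_ }⟩
  refine ⟨⟨(key a).choose, ?_⟩, (key a).choose_spec.1⟩
  have hid : ∀ {A : Type} (l : List A), l.map (Equiv.refl A).invFun = l := fun l => List.map_id l
  have h := (key a).choose_spec.2
  change _ = some (haltList tm _)
  rw [hid, hid]
  exact h

/-! ## A program that checks all small tuples -/

theorem iterIdx_const {X : Type} (g : X → X) (k : ℕ) (x : X) :
    iterIdx (fun _ => g) k x = g^[k] x := by
  induction k with
  | zero => rfl
  | succ k ih => rw [iterate_succ_apply', ← ih]; rfl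

theorem iterIdx_congr {X : Type} {f g : ℕ → X → X} {k : ℕ} (h : ∀ i < k, f i = g i) :
    iterIdx f k = iterIdx g k := by
  induction k with
  | zero => rfl
  | succ k ih =>
    funext x
    rw [iterIdx, iterIdx, h k (Nat.lt_succ_self k), ih fun i hi => h i (by omega)]

namespace LoopProg

section General

variable {V S : Type}

/-- Run the programs in a list one after the other. -/
def seqs (l : List (LoopProg V S)) : LoopProg V S :=
  l.foldr seq (act id)

/-- Nested loops with the given counters and targets. -/
def nest {A : Type} (v t : A → V) (l : List A) (p : LoopProg V S) : LoopProg V S :=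
  l.foldr (fun a p => loop (v a) (t a) p) p

variable [DecidableEq V] {w : List (Option Bool)}

/-- The program moves the head by `d` and does nothing else. -/
def Shift (w : List (Option Bool)) (p : LoopProg V S) (env : V → ℕ) (d : ℕ) : Prop :=
  p.Ok env ∧ ∀ x, p.eval w env x = (x.1, x.2 + d)

theorem Shift.seq {p q : LoopProg V S} {env : V → ℕ} {d e : ℕ} (hp : Shift w p env d)
    (hq : Shift w q env e) : Shift w (p.seq q) env (d + e) :=
  ⟨⟨hp.1, hq.1⟩, fun x => by rw [eval, hp.2, hq.2, add_assoc]⟩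

theorem Shift.seqs {A : Type} {l : List A} {p : A → LoopProg V S} {env : V → ℕ} {d : A → ℕ}
    (h : ∀ a ∈ l, Shift w (p a) env (d a)) : Shift w (seqs (l.map p)) env (l.map d).sum := by
  induction l with
  | nil => exact ⟨trivial, fun x => rfl⟩
  | cons a l ih =>
    rw [List.map_cons, List.map_cons, List.sum_cons]
    exact (h a (by simp)).seq (ih fun b hb => h b (by simp [hb]))

theorem Shift.loop {v t : V} {p : LoopProg V S} {env : V → ℕ} {d : ℕ} (hvt : v ≠ t)
    (ht : env t = 0) (h : ∀ i < env v, Shift w p (shiftEnv env v t i 1) d) :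
    Shift w (loop v t p) env (env v * d) := by
  refine ⟨⟨hvt, ht, fun i hi => (h i hi).1⟩, fun x => ?_⟩
  rw [eval, iterIdx_congr (g := fun _ x => (x.1, x.2 + d)) fun i hi => funext (h i hi).2,
    iterIdx_const]
  induction env v with
  | zero => simp
  | succ k ih => rw [iterate_succ_apply', ih, add_mul, one_mul, add_assoc]

/-- The counters of different levels are distinct, so running an outer loop does not disturb the
inner ones: each level repeats the next one exactly `n` times. -/
theorem nest_read {A : Type} {v t : A → V} (hv : Injective v) (hvt : ∀ a b, v a ≠ t b)
    (ht : Injective t) (f : S → Option (Option Bool) → S) (n : ℕ) (l : List A) (hl : l.Nodup)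
    (env : V → ℕ) (henv : ∀ a ∈ l, env (v a) = n ∧ env (t a) = 0) :
    (nest v t l (read f)).Ok env ∧ ∀ x, (nest v t l (read f)).eval w env x =
      (fun x : S × ℕ => (f x.1 w[x.2]?, x.2 + 1))^[n ^ l.length] x := by
  induction l generalizing env with
  | nil => exact ⟨trivial, fun x => rfl⟩
  | cons a l ih =>
    obtain ⟨ha, hl⟩ := List.nodup_cons.1 hl
    have h : ∀ i, _ := fun i => ih hl (shiftEnv env (v a) (t a) i 1) fun b hb => by
      have hab : b ≠ a := by rintro rfl; exact ha hb
      have := henv b (by simp [hb])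
      simpa [shiftEnv, hv.ne hab, ht.ne hab, hvt b a, (hvt a b).symm] using this
    refine ⟨⟨hvt a a, (henv a (by simp)).2, fun i _ => (h i).1⟩, fun x => ?_⟩
    change iterIdx (fun i => (nest v t l (read f)).eval w (shiftEnv env (v a) (t a) i 1))
      (env (v a)) x = _
    rw [iterIdx_congr (g := fun _ => (fun x : S × ℕ => (f x.1 w[x.2]?, x.2 + 1))^[n ^ l.length])
      fun i _ => funext (h i).2, iterIdx_const, (henv a (by simp)).1, List.length_cons, pow_succ,
      iterate_mul]

end General

/-- The program multiplies the flag in its memory by the truth value of `G`. -/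
def Checks {V T : Type} [DecidableEq V] (w : List (Option Bool)) (p : LoopProg V (Bool × T))
    (env : V → ℕ) (G : Prop) : Prop :=
  p.Ok env ∧ ∀ x, (p.eval w env x).1.1 = true ↔ x.1.1 = true ∧ G

namespace Checks

variable {V T : Type} [DecidableEq V] {w : List (Option Bool)} {p q : LoopProg V (Bool × T)}
  {env : V → ℕ} {G H : Prop}

theorem congr (h : Checks w p env G) (hGH : G ↔ H) : Checks w p env H :=
  ⟨h.1, fun x => by rw [h.2, hGH]⟩

theorem seq (hp : Checks w p env G) (hq : Checks w q env H) :
    Checks w (p.seq q) env (G ∧ H) :=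
  ⟨⟨hp.1, hq.1⟩, fun x => by rw [eval, hq.2, hp.2, and_assoc]⟩

theorem seqs {A : Type} {l : List A} {p : A → LoopProg V (Bool × T)} {G : A → Prop}
    (h : ∀ a ∈ l, Checks w (p a) env (G a)) :
    Checks w (LoopProg.seqs (l.map p)) env (∀ a ∈ l, G a) := by
  induction l with
  | nil => exact ⟨trivial, fun x => by simp [LoopProg.seqs, eval]⟩
  | cons a l ih =>
    exact ((h a (by simp)).seq (ih fun b hb => h b (by simp [hb]))).congr (by simp)

/-- Once lowered, the flag stays down. `Checks` holds for every memory and head position, so what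
one run leaves behind there cannot affect the next. -/
theorem loop {v t : V} {G : ℕ → Prop} (hvt : v ≠ t) (ht : env t = 0)
    (h : ∀ i < env v, Checks w p (shiftEnv env v t i 1) (G i)) :
    Checks w (loop v t p) env (∀ i < env v, G i) := by
  refine ⟨⟨hvt, ht, fun i hi => (h i hi).1⟩, fun x => ?_⟩
  rw [eval]
  generalize env v = k at h
  induction k with
  | zero => simp [iterIdx]
  | succ k ih =>
    rw [iterIdx, (h k (by omega)).2, ih fun i hi => h i (by omega), and_assoc]
    refine and_congr_right fun _ => ⟨fun ⟨h1, h2⟩ i hi => ?_, fun h => ⟨fun i hi => h i (by omega),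
      h k (by omega)⟩⟩
    rcases Nat.lt_succ_iff_lt_or_eq.1 hi with hi | rfl
    exacts [h1 i hi, h2]

end Checks

end LoopProg

/-- The counters of the program: `rem` for the vertices that remain, `gap` for the gaps between the
vertices of a tuple, `dim` and `idx` to loop over the entries of a table, and `aux`. -/
inductive Ctr (B : ℕ)
  | rem
  | aux
  | gap (i : Fin B)
  | dim (i : Fin B)
  | idx (i : Fin B)
  deriving DecidableEq, Fintype

namespace Ctr

open LoopProg

variable {B : ℕ} {S : Type} {w : List (Option Bool)} {n : ℕ} {env : Ctr B → ℕ}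

/-- The counters for tables have their initial values. -/
structure Regular (n : ℕ) (env : Ctr B → ℕ) : Prop where
  dim : ∀ i, env (dim i) = n
  idx : ∀ i, env (idx i) = 0

/-- Read `n ^ e` symbols. -/
def scan (e : ℕ) (f : S → Option (Option Bool) → S) : LoopProg (Ctr B) S :=
  nest dim idx ((List.finRange B).take e) (.read f)

theorem scan_spec (h : Regular n env) {e : ℕ} (he : e ≤ B) (f : S → Option (Option Bool) → S) :
    (scan e f).Ok env ∧ ∀ x, (scan e f).eval w env x =
      (fun x : S × ℕ => (f x.1 w[x.2]?, x.2 + 1))^[n ^ e] x := by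
  have := nest_read (w := w) (v := dim) (t := idx) (fun _ _ => dim.inj) (by simp)
    (fun _ _ => idx.inj) f n ((List.finRange B).take e)
    ((List.take_sublist _ _).nodup (List.nodup_finRange B)) env fun a _ => ⟨h.dim a, h.idx a⟩
  simpa [scan, he] using this

/-- Move the head by `n ^ e`. -/
def skip (e : ℕ) : LoopProg (Ctr B) S :=
  scan e fun s _ => s

theorem shift_skip (h : Regular n env) {e : ℕ} (he : e ≤ B) :
    Shift w (skip e : LoopProg (Ctr B) S) env (n ^ e) := by
  obtain ⟨h1, h2⟩ := scan_spec (w := w) h he fun (s : S) _ => s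
  refine ⟨h1, fun x => ?_⟩
  rw [skip, h2]
  induction n ^ e with
  | zero => rfl
  | succ k ih => rw [iterate_succ_apply', ih, add_assoc]

/-- The sum of the gaps in a list, each increased by one. -/
def gapSum (env : Ctr B → ℕ) (l : List (Fin B)) : ℕ :=
  (l.map fun u => env (gap u) + 1).sum

/-- The vertices that are given by a list of gaps, where the first gap begins at `s`. -/
def vertices (env : Ctr B → ℕ) : ℕ → List (Fin B) → List ℕ
  | _, [] => []
  | s, u :: l => (s + env (gap u)) :: vertices env (s + env (gap u) + 1) l

theorem vertices_append (s : ℕ) (l l' : List (Fin B)) :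
    vertices env s (l ++ l') = vertices env s l ++ vertices env (s + gapSum env l) l' := by
  induction l generalizing s with
  | nil => rfl
  | cons u l ih => simp [vertices, ih, gapSum, add_assoc]

theorem vertices_congr {env' : Ctr B → ℕ} {l : List (Fin B)}
    (h : ∀ u ∈ l, env' (gap u) = env (gap u)) (s : ℕ) : vertices env' s l = vertices env s l := by
  induction l generalizing s with
  | nil => rfl
  | cons u l ih =>
    rw [vertices, vertices, h u (by simp), ih fun v hv => h v (by simp [hv])]

theorem length_vertices (s : ℕ) (l : List (Fin B)) : (vertices env s l).length = l.length := by
  induction l generalizing s with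
  | nil => rfl
  | cons u l ih => simp [vertices, ih]

/-- Each earlier vertex accounts for its gap and for itself. This closed form is the number of jumps
that `moveBy` makes. -/
theorem vertices_getElem (s : ℕ) (l : List (Fin B)) (a : ℕ) (ha : a < l.length) :
    (vertices env s l)[a]'(by rwa [length_vertices]) = s + gapSum env (l.take a) +
      env (gap l[a]) := by
  induction l generalizing s a with
  | nil => simp at ha
  | cons u l ih =>
    cases a with
    | zero => simp [vertices, gapSum]
    | succ a =>
      simp only [vertices, List.getElem_cons_succ]
      rw [ih _ _ (by simpa using ha)]
      simp [gapSum]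
      omega

/-- Move the head by `n ^ e` times the vertex with index `u`. -/
def moveBy (u : Fin B) (e : ℕ) : LoopProg (Ctr B) S :=
  .seq (seqs (((List.finRange B).take u).map fun v =>
    .seq (.loop (gap v) aux (skip e)) (skip e))) (.loop (gap u) aux (skip e))

theorem shift_moveBy (h : Regular n env) (haux : env aux = 0) (u : Fin B) {e : ℕ} (he : e ≤ B) :
    Shift w (moveBy u e : LoopProg (Ctr B) S) env
      ((gapSum env ((List.finRange B).take u) + env (gap u)) * n ^ e) := by
  have hloop : ∀ v, Shift w (.loop (gap v) aux (skip e) : LoopProg (Ctr B) S) env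
      (env (gap v) * n ^ e) := fun v =>
    Shift.loop (by simp) haux fun i _ => shift_skip
      ⟨fun j => by simpa [shiftEnv] using h.dim j, fun j => by simpa [shiftEnv] using h.idx j⟩ he
  have := (Shift.seqs (l := (List.finRange B).take u)
    fun v _ => (hloop v).seq (shift_skip h he)).seq (hloop u)
  convert this using 1
  · rfl
  rw [add_mul, gapSum, ← List.sum_map_mul_right]
  simp [add_mul]

/-- Enumerate the increasing tuples of vertices with indices in `l`. -/
theorem checks_nest {T : Type} {p : LoopProg (Ctr B) (Bool × T)} {gs : List (Fin B)}
    (hgs : gs.Nodup) {G : List ℕ → Prop}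
    (hp : ∀ env : Ctr B → ℕ, Regular n env → env aux = 0 → Checks w p env (G (vertices env 0 gs)))
    (l done : List (Fin B)) (hl : done ++ l = gs) (env : Ctr B → ℕ) (hreg : Regular n env)
    (haux : env aux = 0) (hrem : gapSum env done + env rem = n) (hz : ∀ u ∈ l, env (gap u) = 0) :
    Checks w (nest (fun _ => rem) gap l p) env (∀ t : List ℕ, t.length = l.length →
      t.Pairwise (· < ·) → (∀ x ∈ t, gapSum env done ≤ x ∧ x < n) →
        G (vertices env 0 done ++ t)) := by
  induction l generalizing done env with
  | nil =>
    refine (hp env hreg haux).congr ?_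
    rw [← hl]
    refine ⟨fun h t ht _ _ => ?_, fun h => ?_⟩
    · rw [List.length_eq_zero_iff.1 ht]; simpa using h
    · simpa using h [] rfl (by simp) (by simp)
  | cons u l ih =>
    have hud : u ∉ done := by
      rw [← hl] at hgs
      exact fun h => List.disjoint_of_nodup_append hgs h (by simp)
    have hul : u ∉ l := by
      rw [← hl] at hgs
      exact (List.nodup_cons.1 hgs.of_append_right).1
    have hgap : ∀ i, ∀ v ∈ done, shiftEnv env rem (gap u) i 1 (gap v) = env (gap v) := by
      intro i v hv
      have : v ≠ u := by rintro rfl; exact hud hv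
      simp [shiftEnv, this]
    have hsum : ∀ i, gapSum (shiftEnv env rem (gap u) i 1) done = gapSum env done := fun i => by
      unfold gapSum
      rw [List.map_congr_left fun v hv => by rw [hgap i v hv]]
    -- In run `i` the gap is `i` and `rem` has lost `i + 1` units: the skipped vertices and the
    -- chosen one. This preserves `gapSum + rem = n`, and the next vertex is automatically larger.
    refine (Checks.loop (by simp) (hz u (by simp)) fun i hi => ih (done ++ [u]) (by simpa using hl)
      (shiftEnv env rem (gap u) i 1)
      ⟨fun j => by simpa [shiftEnv] using hreg.dim j, fun j => by simpa [shiftEnv] using hreg.idx j⟩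
      (by simpa [shiftEnv] using haux) ?_ ?_).congr ?_
    · have := hsum i
      simp [gapSum, shiftEnv] at this ⊢
      rw [this]
      simp [gapSum] at hrem
      omega
    · intro v hv
      have : v ≠ u := by rintro rfl; exact hul hv
      simpa [shiftEnv, this] using hz v (by simp [hv])
    · have hv : ∀ i, vertices (shiftEnv env rem (gap u) i 1) 0 (done ++ [u]) =
          vertices env 0 done ++ [gapSum env done + i] := fun i => by
        rw [vertices_append, vertices_congr (hgap i), hsum]
        simp [vertices, shiftEnv]
      have hs : ∀ i, gapSum (shiftEnv env rem (gap u) i 1) (done ++ [u]) =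
          gapSum env done + i + 1 := fun i => by
        have := hsum i
        simp [gapSum] at this ⊢
        rw [this]
        simp [shiftEnv, add_assoc]
      simp only [hv, hs]
      constructor
      · intro h t ht hpw hb
        rcases t with _ | ⟨a, t⟩
        · simp at ht
        · obtain ⟨h1, h2⟩ := List.pairwise_cons.1 hpw
          have ha := hb a (by simp)
          -- The vertex `a` is reached in the run whose index is its distance from the first
          -- admissible vertex.
          have := h (a - gapSum env done) (by omega) t (by simpa using ht) h2 fun x hx => by
            have := h1 x hx
            have := hb x (by simp [hx])
            omega
          rw [Nat.add_sub_cancel' ha.1] at this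
          simpa using this
      · intro h i hi t ht hpw hb
        have := h ((gapSum env done + i) :: t) (by simpa using ht)
          (List.pairwise_cons.2 ⟨fun x hx => by have := hb x hx; omega, hpw⟩) (by
            intro x hx
            rcases List.mem_cons.1 hx with rfl | hx
            · omega
            · have := hb x hx; omega)
        simpa using this

end Ctr

/-- The tape consists, from position `i` on, of blocks of lengths `n ^ e` whose symbols satisfy
`q`, for the pairs `(e, q)` in the list. -/
def HasFormat (w : List (Option Bool)) (n : ℕ) :
    List (ℕ × (Option (Option Bool) → Bool)) → ℕ → Prop
  | [], _ => True
  | a :: l, i => (∀ j < n ^ a.1, a.2 w[i + j]? = true) ∧ HasFormat w n l (i + n ^ a.1)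

/-- The position on the tape of the entry for the tuple `v` in the table that comes after blocks of
lengths `n ^ e`, for `e` in the list `l`. -/
def entryPos (n : ℕ) (l : List ℕ) {k : ℕ} (v : Fin k → ℕ) : ℕ :=
  (l.map (n ^ ·)).sum + ∑ c, v c * n ^ (c : ℕ)

/-! ### Reading table entries and testing tuples -/

namespace Ctr

open LoopProg

section

variable {I : Type} (ar : I → ℕ) (pre : I → List ℕ) (B : ℕ)

/-- The entries of all tables for structures with `m` vertices. -/
abbrev Entry (m : ℕ) : Type := Σ i : I, (Fin (ar i) → Fin m)

/-- The memory: a flag, and truth values for the entries of all tables. -/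
abbrev Mem : Type := Bool × ((Σ m : Fin (B + 1), Entry ar m) → Bool)

variable {ar B}

/-- The index of a vertex among all gaps. -/
def gapIdx {m : Fin (B + 1)} (a : Fin m) : Fin B :=
  Fin.castLE (Nat.lt_succ_iff.1 m.2) a

open Classical in
/-- Store an entry of a table in the memory. -/
noncomputable def lookup (m : Fin (B + 1)) (a : Entry ar m) : LoopProg (Ctr B) (Mem ar B) :=
  .seq .rewind <| .seq (seqs ((pre a.1).map skip)) <|
    .seq (seqs ((List.finRange (ar a.1)).map fun c => moveBy (gapIdx (a.2 c)) c)) <|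
      .read fun s b => (s.1, update s.2 ⟨m, a⟩ (b == some (some true)))

variable {pre} {w : List (Option Bool)} {n : ℕ} {env : Ctr B → ℕ}

/-- After the rewind, the jumps over the preceding blocks and the jumps by multiples of `n ^ c` add
up to `entryPos`. The last clause allows the entries to be collected one by one. -/
theorem lookup_spec (hreg : Regular n env) (haux : env aux = 0) (har : ∀ i, ar i ≤ B)
    (hpre : ∀ i, ∀ e ∈ pre i, e ≤ B) (m : Fin (B + 1)) (a : Entry ar m) :
    (lookup pre m a).Ok env ∧ ∀ x, ((lookup pre m a).eval w env x).1.1 = x.1.1 ∧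
      ((lookup pre m a).eval w env x).1.2 ⟨m, a⟩ = (w[entryPos n (pre a.1) fun c =>
        (vertices env 0 ((List.finRange B).take m)).getD (a.2 c) 0]? == some (some true)) ∧
      ∀ b ≠ a, ((lookup pre m a).eval w env x).1.2 ⟨m, b⟩ = x.1.2 ⟨m, b⟩ := by
  classical
  have h1 := Shift.seqs (w := w) (p := fun e => (skip e : LoopProg (Ctr B) (Mem ar B)))
    (l := pre a.1) fun e he => shift_skip hreg (hpre _ e he)
  have h2 := Shift.seqs (w := w)
    (p := fun c : Fin (ar a.1) =>
      (moveBy (gapIdx (a.2 c)) c : LoopProg (Ctr B) (Mem ar B)))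
    (l := List.finRange (ar a.1)) fun c _ => shift_moveBy hreg haux _
      ((Nat.le_of_lt c.2).trans (har _))
  have hpos : 0 + ((pre a.1).map (n ^ ·)).sum + ((List.finRange (ar a.1)).map fun c : Fin (ar a.1) =>
      (gapSum env ((List.finRange B).take (gapIdx (a.2 c))) + env (gap (gapIdx (a.2 c)))) *
        n ^ (c : ℕ)).sum = entryPos n (pre a.1) fun c =>
        (vertices env 0 ((List.finRange B).take m)).getD (a.2 c) 0 := by
    rw [entryPos, Fin.sum_univ_def, zero_add]
    congr 3
    funext c
    congr 1
    have hm : (m : ℕ) ≤ B := Nat.lt_succ_iff.1 m.2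
    -- The index is in range, so the default value of `getD` plays no role.
    have hlt : (a.2 c : ℕ) < ((List.finRange B).take m).length := by simp [hm]
    rw [List.getD_eq_getElem _ _ (by rwa [length_vertices]), vertices_getElem _ _ _ hlt,
      List.take_take, zero_add]
    congr 2
    · congr 1
      simp [gapIdx]
    · simp [gapIdx]
      rfl
  refine ⟨⟨trivial, h1.1, h2.1, trivial⟩, fun x => ?_⟩
  have : ((lookup pre m a).eval w env x).1 = (x.1.1, update x.1.2 ⟨m, a⟩
      (w[entryPos n (pre a.1) fun c =>
        (vertices env 0 ((List.finRange B).take m)).getD (a.2 c) 0]? == some (some true))) := by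
    rw [lookup, LoopProg.eval, LoopProg.eval, LoopProg.eval, h1.2, LoopProg.eval, h2.2,
      LoopProg.eval, ← hpos]
  rw [this]
  refine ⟨rfl, by simp, fun b hb => update_of_ne (by simpa using hb) _ _⟩

variable (pre) [Finite I]

/-- All entries of tables. -/
noncomputable def entries (ar : I → ℕ) (m : ℕ) : List (Entry ar m) :=
  (Set.toFinite (Set.univ : Set (Entry ar m))).toFinset.toList

open Classical in
/-- Check the condition `good` for a tuple of `m` vertices. -/
noncomputable def checkTuple (good : ∀ m, (Entry ar m → Bool) → Prop) (m : Fin (B + 1)) :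
    LoopProg (Ctr B) (Mem ar B) :=
  .seq (seqs ((entries ar m).map (lookup pre m))) <|
    .act fun s => (s.1 && decide (good m fun a => s.2 ⟨m, a⟩), s.2)

/-- Check the format of the tape, then the condition `good` for all increasing tuples. -/
noncomputable def checkAll (good : ∀ m, (Entry ar m → Bool) → Prop)
    (fmt : List (ℕ × (Option (Option Bool) → Bool))) : LoopProg (Ctr B) (Mem ar B) :=
  .seq (seqs (fmt.map fun a => scan a.1 fun s b => (s.1 && a.2 b, s.2))) <|
    seqs ((List.finRange (B + 1)).map fun m : Fin (B + 1) =>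
      nest (fun _ => rem) gap ((List.finRange B).take m) (checkTuple pre good m))

variable {pre}

/-- All entries for `m` vertices are overwritten before `good` is evaluated, so leftovers from
earlier tuples do no harm. -/
theorem checks_checkTuple (good : ∀ m, (Entry ar m → Bool) → Prop) (har : ∀ i, ar i ≤ B)
    (hpre : ∀ i, ∀ e ∈ pre i, e ≤ B) (m : Fin (B + 1)) (hreg : Regular n env)
    (haux : env aux = 0) :
    Checks w (checkTuple pre good m) env (good m fun a =>
      w[entryPos n (pre a.1) fun c =>
        (vertices env 0 ((List.finRange B).take m)).getD (a.2 c) 0]? == some (some true)) := by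
  classical
  set bit : Entry ar m → Bool := fun a =>
      w[entryPos n (pre a.1) fun c =>
        (vertices env 0 ((List.finRange B).take m)).getD (a.2 c) 0]? == some (some true) with hbit
  -- The alternative that an entry is already correct carries the induction: later lookups do not
  -- spoil it.
  have key : ∀ l : List (Entry ar m), (seqs (l.map (lookup pre m))).Ok env ∧ ∀ x,
      ((seqs (l.map (lookup pre m))).eval w env x).1.1 = x.1.1 ∧
      ∀ a, (a ∈ l ∨ x.1.2 ⟨m, a⟩ = bit a) →
        ((seqs (l.map (lookup pre m))).eval w env x).1.2 ⟨m, a⟩ = bit a := by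
    intro l
    induction l with
    | nil => exact ⟨trivial, fun x => ⟨rfl, fun a ha => ha.resolve_left (by simp)⟩⟩
    | cons b l ih =>
      obtain ⟨h1, h2⟩ := lookup_spec (w := w) hreg haux har hpre m b
      refine ⟨⟨h1, ih.1⟩, fun x => ?_⟩
      obtain ⟨h3, h4, h5⟩ := h2 x
      obtain ⟨h6, h7⟩ := ih.2 ((lookup pre m b).eval w env x)
      refine ⟨h6.trans h3, fun a ha => h7 a ?_⟩
      by_cases hab : a = b
      · subst hab; exact Or.inr h4
      · rw [h5 a hab]
        simpa [hab] using ha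
  obtain ⟨h1, h2⟩ := key (entries ar m)
  refine ⟨⟨h1, trivial⟩, fun x => ?_⟩
  obtain ⟨h3, h4⟩ := h2 x
  have h5 : (fun a => ((seqs ((entries ar m).map (lookup pre m))).eval w env x).1.2 ⟨m, a⟩) =
      bit := funext fun a => h4 a (Or.inl (by simp [entries]))
  simp only [checkTuple, LoopProg.eval, Bool.and_eq_true, decide_eq_true_eq]
  rw [h3, h5]

theorem checkAll_spec (good : ∀ m, (Entry ar m → Bool) → Prop) (har : ∀ i, ar i ≤ B)
    (hpre : ∀ i, ∀ e ∈ pre i, e ≤ B) (fmt : List (ℕ × (Option (Option Bool) → Bool)))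
    (hfmt : ∀ a ∈ fmt, a.1 ≤ B) (hreg : Regular n env) (haux : env aux = 0)
    (hrem : env rem = n) (hgap : ∀ u, env (gap u) = 0) (s : Mem ar B) :
    (checkAll pre good fmt).Ok env ∧
      (((checkAll pre good fmt).eval w env (s, 0)).1.1 = true ↔ s.1 = true ∧
        HasFormat w n fmt 0 ∧ ∀ (m : Fin (B + 1)) (t : List ℕ), t.length = m →
          t.Pairwise (· < ·) → (∀ x ∈ t, x < n) →
            good m fun a => w[entryPos n (pre a.1) fun c => t.getD (a.2 c) 0]? ==
              some (some true)) := by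
  -- `Checks` ignores the head and is too weak here, since each block begins where the previous one
  -- ends. The tuple checks do not need the head, because every lookup rewinds.
  have hF : (seqs (fmt.map fun a => scan a.1 fun (s : Mem ar B) b => (s.1 && a.2 b, s.2))).Ok env ∧
      ∀ x, ((seqs (fmt.map fun a => scan a.1 fun (s : Mem ar B) b =>
        (s.1 && a.2 b, s.2))).eval w env x).1.1 = true ↔
          x.1.1 = true ∧ HasFormat w n fmt x.2 := by
    induction fmt with
    | nil => exact ⟨trivial, fun x => by simp [HasFormat, seqs, LoopProg.eval]⟩
    | cons a l ih =>
      obtain ⟨h1, h2⟩ := ih fun b hb => hfmt b (by simp [hb])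
      obtain ⟨h3, h4⟩ := scan_spec (w := w) hreg (hfmt a (by simp))
        fun (s : Mem ar B) b => (s.1 && a.2 b, s.2)
      refine ⟨⟨h3, h1⟩, fun x => (h2 _).trans ?_⟩
      rw [h4]
      have : ∀ k, ((fun x : Mem ar B × ℕ => ((x.1.1 && a.2 w[x.2]?, x.1.2), x.2 + 1))^[k] x).2 =
          x.2 + k ∧
          (((fun x : Mem ar B × ℕ => ((x.1.1 && a.2 w[x.2]?, x.1.2), x.2 + 1))^[k] x).1.1 = true ↔
            x.1.1 = true ∧ ∀ j < k, a.2 w[x.2 + j]? = true) := by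
        intro k
        induction k with
        | zero => simp
        | succ k ih =>
          rw [iterate_succ_apply']
          refine ⟨by simp [ih.1, add_assoc], ?_⟩
          simp only [Bool.and_eq_true, ih.1, ih.2, and_assoc, Nat.lt_succ_iff_lt_or_eq, or_imp,
            forall_and, forall_eq]
      rw [(this _).1, (this _).2, HasFormat, and_assoc]
  have hC := Checks.seqs (w := w) (env := env) (l := List.finRange (B + 1))
    (p := fun m => nest (fun _ => rem) gap ((List.finRange B).take m) (checkTuple pre good m))
    fun m _ => checks_nest ((List.take_sublist _ _).nodup (List.nodup_finRange B))
      (G := fun t => good m fun a => w[entryPos n (pre a.1) fun c => t.getD (a.2 c) 0]? ==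
              some (some true))
      (fun env hreg haux => checks_checkTuple good har hpre m hreg haux) _ [] rfl env hreg haux
      (by simp [gapSum, hrem]) fun u _ => hgap u
  refine ⟨⟨hF.1, hC.1⟩, (hC.2 _).trans ?_⟩
  rw [hF.2, and_assoc]
  refine and_congr_right fun _ => and_congr_right fun _ => ?_
  have hm : ∀ m : Fin (B + 1), (m : ℕ) ≤ B := fun m => Nat.lt_succ_iff.1 m.2
  simp [gapSum, vertices, hm]

end

end Ctr

/-- Whether a tape has a given format, and a condition on the entries of tables holds for all
increasing tuples of bounded length, can be decided in polynomial time. -/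
theorem computableInPolyTime_of_local {α I : Type} [Finite I] (ar : I → ℕ) (pre : I → List ℕ)
    (B : ℕ) (good : ∀ m, (Ctr.Entry ar m → Bool) → Prop) (har : ∀ i, ar i ≤ B)
    (hpre : ∀ i, ∀ e ∈ pre i, e ≤ B) (fmt : List (ℕ × (Option (Option Bool) → Bool)))
    (hfmt : ∀ a ∈ fmt, a.1 ≤ B) (ea : α → List (Option Bool)) (g : α → Bool)
    (hg : ∀ a, g a = true ↔ HasFormat (ea a) (leadTrue (ea a)) fmt 0 ∧
      ∀ (m : Fin (B + 1)) (t : List ℕ), t.length = m → t.Pairwise (· < ·) →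
        (∀ x ∈ t, x < leadTrue (ea a)) → good m fun b =>
          (ea a)[entryPos (leadTrue (ea a)) (pre b.1) fun c => t.getD (b.2 c) 0]? ==
            some (some true)) :
    Nonempty (Turing.TM2ComputableInPolyTime ea Computability.encodeBool g) := by
  let src : List (Ctr B) := .rem :: (List.finRange B).map .dim
  have hsrc : src.Nodup := List.nodup_cons.2 ⟨by simp,
    (List.nodup_finRange B).map fun _ _ => Ctr.dim.inj⟩
  have key := fun (w : List (Option Bool)) n => Ctr.checkAll_spec (w := w) (n := n)
    (env := initEnv src n) good har hpre fmt hfmt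
    ⟨by simp [initEnv, src], by simp [initEnv, src]⟩ (by simp [initEnv, src])
    (by simp [initEnv, src]) (by simp [initEnv, src]) (true, fun _ => false)
  refine computableInPolyTime_of_loopProg (Ctr.checkAll pre good fmt) src hsrc
    -- `Ok` does not involve the tape, so the empty tape serves.
    (true, fun _ => false) (fun s => s.1) ea g (fun n => (key [] n).1) fun a => ?_
  rw [Bool.eq_iff_iff, (key _ _).2, hg]
  simp

/-! ## Positions and formats of encodings -/

section Encoding

variable {L : FirstOrder.Language.{0, 0}} {s : ℕ} (e : Fin s ≃ Σ k, L.Relations k)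

/-- The exponents of the lengths of the blocks before the table of the `i`-th relation symbol. -/
def tablePrefix (i : ℕ) : List ℕ :=
  -- The exponent 1 stands for the `n` leading ones, the exponent 0 for the single `false` after
  -- them.
  [1, 0] ++ ((List.finRange s).take i).map fun j => (e j).1

open Classical in
/-- The table of a relation. -/
noncomputable def relTable {n : ℕ} (A : L.Structure (Fin n)) (i : Fin s) : List Bool :=
  List.ofFn fun j : Fin (n ^ (e i).1) => decide (A.RelMap (e i).2 (finFunctionFinEquiv.symm j))

theorem encodeStructure_eq {n : ℕ} (A : L.Structure (Fin n)) :
    encodeStructure e A =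
      List.replicate n true ++ false :: (List.finRange s).flatMap (relTable e A) :=
  rfl

theorem length_encodeStructure {n : ℕ} (A : L.Structure (Fin n)) :
    (encodeStructure e A).length = ((tablePrefix e s).map (n ^ ·)).sum := by
  have : (List.finRange s).take s = List.finRange s := List.take_of_length_le (by simp)
  simp [encodeStructure_eq, relTable, tablePrefix, this, List.length_flatMap, Function.comp_def]
  omega

-- Cut the encoding just before the table in question; inside the table, `finFunctionFinEquiv v` is
-- the sum of the `v c * n ^ c`, as in `entryPos`.
open Classical in
theorem encodeStructure_getElem? {n : ℕ} (A : L.Structure (Fin n)) (R : Σ k, L.Relations k)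
    (v : Fin R.1 → Fin n) :
    (encodeStructure e A)[entryPos n (tablePrefix e (e.symm R)) fun c => v c]? =
      some (decide (A.RelMap R.2 v)) := by
  obtain ⟨i, rfl⟩ := e.surjective R
  obtain ⟨j, rfl⟩ := finFunctionFinEquiv.symm.surjective v
  rw [e.symm_apply_apply, entryPos, ← finFunctionFinEquiv_apply, Equiv.apply_symm_apply]
  have hsplit : List.finRange s = (List.finRange s).take i ++ i :: (List.finRange s).drop (i + 1) := by
    conv_lhs => rw [← List.take_append_drop i (List.finRange s)]
    rw [List.drop_eq_getElem_cons (by simp)]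
    simp
  have hlen : (((List.finRange s).take i).flatMap (relTable e A)).length =
      (((List.finRange s).take i).map fun j => n ^ (e j).1).sum := by
    simp [List.length_flatMap, relTable]
  have hpos : ((tablePrefix e i).map (n ^ ·)).sum =
      (List.replicate n true ++ false :: ((List.finRange s).take i).flatMap (relTable e A)).length := by
    simp only [List.length_append, List.length_cons, List.length_replicate, hlen]
    simp [tablePrefix, Function.comp_def]
    omega
  have henc : encodeStructure e A =
      (List.replicate n true ++ false :: ((List.finRange s).take i).flatMap (relTable e A)) ++
        (relTable e A i ++ ((List.finRange s).drop (i + 1)).flatMap (relTable e A)) := by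
    rw [encodeStructure_eq]
    conv_lhs => rw [hsplit]
    simp
  rw [henc, hpos, List.getElem?_append_right (by omega), Nat.add_sub_cancel_left,
    List.getElem?_append_left (by simp [relTable])]
  simp [relTable]

/-- A test whether a symbol is a bit that satisfies `p`. -/
def bitTest (p : Bool → Bool) : Option (Option Bool) → Bool
  | some (some b) => p b
  | _ => false

/-- The format of the encodings of structures. -/
def structFormat : List (ℕ × (Option (Option Bool) → Bool)) :=
  (1, bitTest id) :: (0, bitTest not) :: (List.finRange s).map fun i => ((e i).1, bitTest fun _ => true)

theorem hasFormat_append_left (u w : List (Option Bool)) (n : ℕ)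
    (l : List (ℕ × (Option (Option Bool) → Bool))) (i : ℕ) :
    HasFormat (u ++ w) n l (u.length + i) ↔ HasFormat w n l i := by
  induction l generalizing i with
  | nil => rfl
  | cons a l ih =>
    rw [HasFormat, HasFormat, add_assoc, ih]
    simp only [add_assoc, List.getElem?_append_right (Nat.le_add_right _ _), Nat.add_sub_cancel_left]

variable {z : List (Option Bool)} {n : ℕ} {rest : List (ℕ × (Option (Option Bool) → Bool))}

/-- As `z` does not begin with a bit, a block of bits cannot run out of `x` into `z`; this makes `x`
long enough to be split. -/
theorem hasFormat_bits (hz : ∀ b, z[0]? ≠ some (some b)) (x : List Bool) (k : ℕ) (p : Bool → Bool) :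
    HasFormat (x.map some ++ z) n ((k, bitTest p) :: rest) 0 ↔
      ∃ u v, x = u ++ v ∧ u.length = n ^ k ∧ (∀ b ∈ u, p b = true) ∧
        HasFormat (v.map some ++ z) n rest 0 := by
  rw [HasFormat]
  simp only [zero_add]
  constructor
  · rintro ⟨h1, h2⟩
    have hle : n ^ k ≤ x.length := by
      by_contra hlt
      have := h1 x.length (by omega)
      rw [List.getElem?_append_right (by simp)] at this
      simp only [List.length_map, Nat.sub_self] at this
      rcases h : z[0]? with _ | _ | b
      · simp [h, bitTest] at this
      · simp [h, bitTest] at this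
      · exact hz b h
    refine ⟨x.take (n ^ k), x.drop (n ^ k), by simp, by simpa using hle, fun b hb => ?_, ?_⟩
    · obtain ⟨j, hj, rfl⟩ := List.getElem_of_mem hb
      simp at hj
      simpa [List.getElem?_append_left, hj, bitTest] using h1 j hj.1
    · have hl : ((x.take (n ^ k)).map some).length + 0 = n ^ k := by simpa using hle
      rw [← hasFormat_append_left ((x.take (n ^ k)).map some), hl, ← List.append_assoc,
        ← List.map_append, List.take_append_drop]
      exact h2
  · rintro ⟨u, v, rfl, hu, hp, h⟩
    refine ⟨fun j hj => ?_, ?_⟩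
    · rw [← hu] at hj
      simpa [List.getElem?_append_left, hj, bitTest, Nat.lt_add_right] using
        hp _ (List.getElem_mem hj)
    · have := (hasFormat_append_left (u.map some) _ n rest 0).2 h
      simpa [hu] using this

theorem hasFormat_tables (hz : ∀ b, z[0]? ≠ some (some b)) {A : Type} [DecidableEq A] (ar : A → ℕ)
    (l : List A) (hl : l.Nodup) (x : List Bool) :
    HasFormat (x.map some ++ z) n (l.map (fun a => (ar a, bitTest fun _ => true)) ++ rest) 0 ↔
      ∃ T : A → List Bool, (∀ a ∈ l, (T a).length = n ^ ar a) ∧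
        ∃ v, x = l.flatMap T ++ v ∧ HasFormat (v.map some ++ z) n rest 0 := by
  induction l generalizing x with
  | nil => simp
  | cons a l ih =>
    obtain ⟨ha, hl⟩ := List.nodup_cons.1 hl
    rw [List.map_cons, List.cons_append, hasFormat_bits hz]
    constructor
    · rintro ⟨u, v, rfl, hu, -, h⟩
      obtain ⟨T, hT, v, rfl, h'⟩ := (ih hl v).1 h
      have hne : ∀ b ∈ l, b ≠ a := by rintro b hb rfl; exact ha hb
      refine ⟨update T a u, ?_, v, ?_, h'⟩
      · intro b hb
        rcases List.mem_cons.1 hb with rfl | hb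
        · simpa using hu
        · rw [update_of_ne (hne b hb)]; exact hT b hb
      · have : l.flatMap (update T a u) = l.flatMap T :=
          List.flatMap_congr fun b hb => update_of_ne (hne b hb) _ _
        simp [this]
    · rintro ⟨T, hT, v, rfl, h⟩
      exact ⟨T a, l.flatMap T ++ v, by simp, hT a (by simp), by simp,
        (ih hl _).2 ⟨T, fun b hb => hT b (by simp [hb]), v, rfl, h⟩⟩

theorem hasFormat_delim (x : List Bool) (q : Option (Option Bool) → Bool)
    (hq : ∀ b, q (some (some b)) = false) :
    HasFormat (x.map some ++ z) n ((0, q) :: rest) 0 ↔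
      x = [] ∧ HasFormat z n ((0, q) :: rest) 0 := by
  rcases x with _ | ⟨b, x⟩
  · simp
  · simp [HasFormat, hq]

/-- Any bits of the right lengths are the tables of some structure, so only the shape matters. The
test `q` fails on bits and thereby forces `x` to end with its last table. -/
theorem hasFormat_structFormat [L.IsRelational] (hz : ∀ b, z[0]? ≠ some (some b)) (x : List Bool)
    (q : Option (Option Bool) → Bool) (hq : ∀ b, q (some (some b)) = false) :
    HasFormat (x.map some ++ z) n (structFormat e ++ (0, q) :: rest) 0 ↔
      (∃ A : L.Structure (Fin n), encodeStructure e A = x) ∧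
        HasFormat z n ((0, q) :: rest) 0 := by
  classical
  simp only [structFormat, List.cons_append, hasFormat_bits hz,
    hasFormat_tables hz _ _ (List.nodup_finRange s), hasFormat_delim _ _ hq]
  constructor
  · rintro ⟨u, _, rfl, hu, hu', u', _, rfl, hv, hv', T, hT, _, rfl, rfl, h⟩
    refine ⟨⟨⟨fun f => isEmptyElim f, fun {k} R v =>
      (T (e.symm ⟨k, R⟩))[(finFunctionFinEquiv v : ℕ)]? = some true⟩, ?_⟩, h⟩
    have h1 : u = List.replicate n true := by
      rw [List.eq_replicate_iff]
      exact ⟨by simpa using hu, fun b hb => by simpa using hu' b hb⟩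
    have h2 : u' = [false] := by
      obtain ⟨b, rfl⟩ := List.length_eq_one_iff.1 (by simpa using hv)
      simpa using hv'
    subst h1 h2
    rw [encodeStructure_eq]
    simp only [List.append_nil, List.cons_append, List.nil_append]
    congr 2
    refine List.flatMap_congr fun i _ => ?_
    refine List.ext_getElem (by simp [relTable, hT]) fun j h1 h2 => ?_
    simp [relTable, h2]
  · rintro ⟨⟨A, rfl⟩, h⟩
    exact ⟨List.replicate n true, _, encodeStructure_eq e A, by simp, by simp, [false], _, rfl,
      by simp, by simp, relTable e A, by simp [relTable], [], (List.append_nil _).symm, rfl, h⟩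

/-- The format of the pairs of encodings. -/
def pairFormat {L' : FirstOrder.Language.{0, 0}} {r : ℕ} (e' : Fin r ≃ Σ k, L'.Relations k) :
    List (ℕ × (Option (Option Bool) → Bool)) :=
  structFormat e ++ (0, fun c => c == some none) :: (structFormat e' ++ [(0, fun c => c == none)])

/-- The first string is closed off by the separator `some none`, the second by the end of the tape,
which is read as `none`. The common `n` makes the vertex sets agree. -/
theorem hasFormat_pairFormat {L' : FirstOrder.Language.{0, 0}} [L.IsRelational] [L'.IsRelational] {r : ℕ}
    (e' : Fin r ≃ Σ k, L'.Relations k) (x y : List Bool) :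
    HasFormat (encodePair (x, y)) n (pairFormat e e') 0 ↔
      (∃ A : L.Structure (Fin n), encodeStructure e A = x) ∧
        ∃ A' : L'.Structure (Fin n), encodeStructure e' A' = y := by
  rw [encodePair, pairFormat, hasFormat_structFormat e (by simp) _ _ (by simp)]
  refine and_congr_right fun _ => ?_
  have h1 := hasFormat_append_left [none] (y.map some) n
    (structFormat e' ++ [(0, fun c => c == none)]) 0
  have h2 := hasFormat_structFormat (z := []) (n := n) (rest := []) e' (by simp) y
    (fun c => c == none) (by simp)
  rw [List.append_nil] at h2
  rw [HasFormat]
  simp [HasFormat] at h1 h2 ⊢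
  rw [h1, h2]

theorem leadTrue_encodePair (A : L.Structure (Fin n)) (y : List Bool) :
    leadTrue (encodePair (encodeStructure e A, y)) = n := by
  have key : ∀ (k : ℕ) (z : List (Option Bool)),
      leadTrue (List.replicate k (some true) ++ some false :: z) = k := by
    intro k z
    induction k with
    | zero => rfl
    | succ k ih =>
      rw [leadTrue] at ih ⊢
      rw [List.replicate_succ, List.cons_append, List.findIdx_cons, ih]
      rfl
  rw [encodePair, encodeStructure_eq]
  simpa using key n _

end Encoding

open FirstOrder.Language

/-! ## Local classes and concrete functors -/

section Pullback

variable {L : FirstOrder.Language.{0, 0}} [L.IsRelational]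

/-- The structure on `V` that is induced along a map to the vertex set of a structure. -/
@[reducible] def pullback {V W : Type} (A : L.Structure W) (t : V → W) : L.Structure V where
  funMap f := isEmptyElim f
  RelMap R v := A.RelMap R (t ∘ v)

/-- The relational structure with the given truth values. -/
@[reducible] def ofBits {V : Type} (b : (R : Σ k, L.Relations k) → (Fin R.1 → V) → Bool) : L.Structure V where
  funMap f := isEmptyElim f
  RelMap {k} R v := b ⟨k, R⟩ v = true

theorem structure_ext {V : Type} {A B : L.Structure V}
    (h : ∀ (R : Σ k, L.Relations k) (v : Fin R.1 → V), A.RelMap R.2 v ↔ B.RelMap R.2 v) :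
    A = B := by
  refine FirstOrder.Language.Structure.ext ?_ ?_
  · funext k f; exact isEmptyElim f
  · funext k R v; exact propext (h ⟨k, R⟩ v)

/-- An injective map is an embedding of the structure that it induces. -/
def pullbackEmbedding {V W : Type} (A : L.Structure W) (t : V ↪ W) :
    @FirstOrder.Language.Embedding L V W (pullback A t) A :=
  letI := pullback A t
  { t with
    map_fun' := fun f => isEmptyElim f
    map_rel' := fun _ _ => Iff.rfl }

end Pullback

section Local

variable {σ τ : FirstOrder.Language.{0, 0}} [σ.IsRelational] [τ.IsRelational]
  {C : StructureClass σ} {D : StructureClass τ}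

-- Locality implies heredity: a small substructure of `A` is isomorphic to its image, which is a
-- small substructure of `B`.
omit [σ.IsRelational] in
theorem StructureClass.IsLocal.mem_of_embedding (hC : C.IsLocal) {V W : Type} [Finite V] [Finite W]
    (A : σ.Structure V) (B : σ.Structure W) (f : @FirstOrder.Language.Embedding σ V W A B)
    (hB : C.Mem B) : C.Mem A := by
  obtain ⟨N, -, h⟩ := hC
  refine (h A).2 fun S hS => ?_
  let g := f.substructureEquivMap S
  refine C.mem_of_equiv _ _ ⟨g.symm⟩ ((h B).1 hB _ ?_)
  rwa [← Nat.card_congr g.toEquiv]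

/-- The map `t` embeds the induced structure into `A`. By concreteness the same map embeds the
images under `F`, and an embedding determines the relations on its source. -/
theorem ConcreteFunctor.obj_pullback (F : ConcreteFunctor C D) {V W : Type} [Finite V] [Finite W]
    (A : σ.Structure W) (t : V ↪ W) (hA : C.Mem A) (h : C.Mem (pullback A t)) :
    F.obj (pullback A t) h = pullback (F.obj A hA) t := by
  obtain ⟨g, hg⟩ := F.map _ _ h hA (pullbackEmbedding A t)
  refine structure_ext fun R v => ?_
  let := F.obj (pullback A t) h
  let := F.obj A hA
  have h1 := g.map_rel' R.2 v
  have h2 : g.toFun = t := hg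
  rw [h2] at h1
  exact h1.symm

/-- A finite set of vertices is the range of an increasing tuple. -/
theorem exists_strictMono_range {n : ℕ} (s : Finset (Fin n)) :
    ∃ t : Fin s.card → Fin n, StrictMono t ∧ Set.range t = s :=
  ⟨s.orderEmbOfFin rfl, (s.orderEmbOfFin rfl).strictMono, s.range_orderEmbOfFin rfl⟩

/-- Whether `F` maps `A` to `A'` can be decided by looking at small sets of vertices. -/
theorem ConcreteFunctor.obj_eq_iff (F : ConcreteFunctor C D) (hC : C.IsLocal) :
    ∃ N, ∀ B, N ≤ B → (∀ R : Σ k, τ.Relations k, R.1 ≤ B) →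
      ∀ {n : ℕ} (A : σ.Structure (Fin n)) (A' : τ.Structure (Fin n)),
        (∃ hA : C.Mem A, F.obj A hA = A') ↔
          ∀ (m : Fin (B + 1)) (t : Fin m → Fin n), StrictMono t →
            ∃ h : C.Mem (pullback A t), F.obj _ h = pullback A' t := by
  classical
  obtain ⟨N, hN, hloc⟩ := id hC
  refine ⟨N, fun B hNB hB n A A' => ⟨?_, fun H => ?_⟩⟩
  · rintro ⟨hA, rfl⟩ m t ht
    have h := hC.mem_of_embedding (pullback A t) A (pullbackEmbedding A ⟨t, ht.injective⟩) hA
    exact ⟨h, F.obj_pullback A ⟨t, ht.injective⟩ hA h⟩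
  · have H' : ∀ s : Finset (Fin n), s.card ≤ B → ∃ (m : ℕ) (t : Fin m → Fin n), StrictMono t ∧
        Set.range t = s ∧ ∃ h : C.Mem (pullback A t), F.obj _ h = pullback A' t := fun s hs =>
      have ⟨t, ht, hr⟩ := exists_strictMono_range s
      ⟨_, t, ht, hr, H ⟨s.card, Nat.lt_succ_of_le hs⟩ t ht⟩
    -- Locality applies, since every substructure with at most `N ≤ B` vertices is isomorphic to one
    -- of the tested pullbacks.
    have hA : C.Mem A := by
      refine (hloc A).2 fun S hS => ?_
      obtain ⟨m, t, ht, hr, hm, -⟩ := H' (S : Set (Fin n)).toFinset (by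
        rw [← Set.ncard_eq_toFinset_card']
        exact hS.trans hNB)
      rw [Set.coe_toFinset] at hr
      refine C.mem_of_equiv (pullback A t) _ ?_ hm
      let := pullback A t
      refine ⟨{ Equiv.ofBijective (fun c => (⟨t c, by
          rw [← SetLike.mem_coe, ← hr]; exact ⟨c, rfl⟩⟩ : S)) ⟨fun a b hab => ht.injective
            (congrArg Subtype.val hab), fun ⟨x, hx⟩ => ?_⟩ with
        map_fun' := fun f => isEmptyElim f
        map_rel' := fun _ _ => Iff.rfl }⟩
      rw [← SetLike.mem_coe, ← hr] at hx
      obtain ⟨c, rfl⟩ := hx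
      exact ⟨c, rfl⟩
    refine ⟨hA, structure_ext fun R v => ?_⟩
    -- The entries of `v` form a set no larger than the arity, so a tested tuple `t` covers them and
    -- `v` factors through it.
    obtain ⟨m, t, ht, hr, hm, he⟩ := H' (Finset.univ.image v)
      (Finset.card_image_le.trans (by simpa using hB R))
    have hv : ∀ c, ∃ a, t a = v c := fun c => by
      have : v c ∈ Set.range t := by rw [hr]; simp
      exact this
    choose v' hv' using hv
    have h1 := F.obj_pullback A ⟨t, ht.injective⟩ hA hm
    have h2 : pullback (F.obj A hA) t = pullback A' t := h1.symm.trans he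
    have h3 : (pullback (F.obj A hA) t).RelMap R.2 v' ↔ (pullback A' t).RelMap R.2 v' := by rw [h2]
    rw [show v = t ∘ v' from funext fun c => (hv' c).symm]
    exact h3

end Local

/-! ## Certificates -/

section Certificates

variable {σ τ : FirstOrder.Language.{0, 0}} {C : StructureClass σ} {D : StructureClass τ}
  (F : ConcreteFunctor C D) {r s : ℕ} (eσ : Fin r ≃ Σ k, σ.Relations k)
  (eτ : Fin s ≃ Σ k, τ.Relations k)

/-- The exponents of the lengths of the blocks before a table in the encoding of a pair. -/
def pairPrefix : (Σ k, τ.Relations k) ⊕ (Σ k, σ.Relations k) → List ℕ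
  | .inl R => tablePrefix eτ (eτ.symm R)
  -- The whole first encoding, then the separator as a block of length `n ^ 0`.
  | .inr R => tablePrefix eτ s ++ 0 :: tablePrefix eσ (eσ.symm R)

/-- The arities of the relation symbols of two signatures. -/
def pairArity : (Σ k, τ.Relations k) ⊕ (Σ k, σ.Relations k) → ℕ
  | .inl R => R.1
  | .inr R => R.1

open Classical in
theorem encodePair_getElem?_inl {n : ℕ} (A : σ.Structure (Fin n)) (A' : τ.Structure (Fin n))
    (R : Σ k, τ.Relations k) (v : Fin R.1 → Fin n) :
    (encodePair (encodeStructure eτ A', encodeStructure eσ A))[entryPos n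
      (pairPrefix eσ eτ (.inl R)) fun c => v c]? = some (some (decide (A'.RelMap R.2 v))) := by
  have h := encodeStructure_getElem? eτ A' R v
  obtain ⟨h1, -⟩ := List.getElem?_eq_some_iff.1 h
  rw [pairPrefix, encodePair, List.getElem?_append_left (by simpa using h1), List.getElem?_map, h]
  rfl

open Classical in
theorem encodePair_getElem?_inr {n : ℕ} (A : σ.Structure (Fin n)) (A' : τ.Structure (Fin n))
    (R : Σ k, σ.Relations k) (v : Fin R.1 → Fin n) :
    (encodePair (encodeStructure eτ A', encodeStructure eσ A))[entryPos n
      (pairPrefix eσ eτ (.inr R)) fun c => v c]? = some (some (decide (A.RelMap R.2 v))) := by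
  have h := encodeStructure_getElem? eσ A R v
  have hpos : entryPos n (pairPrefix eσ eτ (.inr R)) (fun c => (v c : ℕ)) =
      (encodeStructure eτ A').length + (entryPos n (tablePrefix eσ (eσ.symm R)) (fun c => (v c : ℕ)) + 1) := by
    rw [length_encodeStructure]
    simp [entryPos, pairPrefix]
    omega
  rw [hpos, encodePair, List.getElem?_append_right (by simp)]
  simp [h]

/-- The condition on the substructures that the structures in a certificate induce on a set of `m`
vertices. -/
def ConcreteFunctor.Good [σ.IsRelational] [τ.IsRelational] (m : ℕ)
    (b : Ctr.Entry (pairArity (σ := σ) (τ := τ)) m → Bool) : Prop :=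
  ∃ h : C.Mem (ofBits fun R v => b ⟨.inr R, v⟩), F.obj _ h = ofBits fun R v => b ⟨.inl R, v⟩

theorem tablePrefix_le {L : FirstOrder.Language.{0, 0}} {q : ℕ} (e : Fin q ≃ Σ k, L.Relations k)
    {B : ℕ} (h1 : 1 ≤ B) (hB : ∀ R : Σ k, L.Relations k, R.1 ≤ B) (i : ℕ) :
    ∀ a ∈ tablePrefix e i, a ≤ B := by
  intro a ha
  simp only [tablePrefix, List.cons_append, List.nil_append, List.mem_cons, List.mem_map] at ha
  rcases ha with rfl | rfl | ⟨j, -, rfl⟩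
  exacts [h1, Nat.zero_le _, hB _]

theorem pairFormat_le {B : ℕ} (h1 : 1 ≤ B) (hσ : ∀ R : Σ k, σ.Relations k, R.1 ≤ B)
    (hτ : ∀ R : Σ k, τ.Relations k, R.1 ≤ B) : ∀ a ∈ pairFormat eτ eσ, a.1 ≤ B := by
  intro a ha
  simp only [pairFormat, structFormat, List.cons_append, List.mem_cons, List.mem_append,
    List.mem_map, List.not_mem_nil, or_false] at ha
  rcases ha with rfl | rfl | ⟨j, -, rfl⟩ | rfl | rfl | rfl | ⟨j, -, rfl⟩ | rfl <;> simp [*]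

/-- The bits read from the tape at a tuple are the relations of the two structures pulled back along
it. Here the program's lists of numbers meet the maps `t` of `ConcreteFunctor.obj_eq_iff`. -/
theorem good_iff [σ.IsRelational] [τ.IsRelational] {n m : ℕ} (A : σ.Structure (Fin n))
    (A' : τ.Structure (Fin n)) (l : List ℕ) (t : Fin m → Fin n)
    (hl : ∀ c : Fin m, l.getD c 0 = t c) :
    (F.Good m fun b =>
      (encodePair (encodeStructure eτ A', encodeStructure eσ A))[entryPos n
        (pairPrefix eσ eτ b.1) fun c => l.getD (b.2 c) 0]? == some (some true)) ↔
      ∃ h : C.Mem (pullback A t), F.obj _ h = pullback A' t := by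
  classical
  have e1 : (ofBits fun (R : Σ k, σ.Relations k) (v : Fin R.1 → Fin m) =>
      (encodePair (encodeStructure eτ A', encodeStructure eσ A))[entryPos n
        (pairPrefix eσ eτ (.inr R)) fun c => l.getD (v c) 0]? == some (some true)) =
      pullback A t := by
    refine structure_ext fun R v => ?_
    have := encodePair_getElem?_inr eσ eτ A A' R (t ∘ v)
    rw [← show (fun c => l.getD (v c) 0) = fun c => ((t ∘ v) c : ℕ) from
      funext fun c => hl (v c)] at this
    change (_ == some (some true)) = true ↔ A.RelMap R.2 (t ∘ v)
    rw [this]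
    simp only [beq_iff_eq, Option.some.injEq, decide_eq_true_eq]
  have e2 : (ofBits fun (R : Σ k, τ.Relations k) (v : Fin R.1 → Fin m) =>
      (encodePair (encodeStructure eτ A', encodeStructure eσ A))[entryPos n
        (pairPrefix eσ eτ (.inl R)) fun c => l.getD (v c) 0]? == some (some true)) =
      pullback A' t := by
    refine structure_ext fun R v => ?_
    have := encodePair_getElem?_inl eσ eτ A A' R (t ∘ v)
    rw [← show (fun c => l.getD (v c) 0) = fun c => ((t ∘ v) c : ℕ) from
      funext fun c => hl (v c)] at this
    change (_ == some (some true)) = true ↔ A'.RelMap R.2 (t ∘ v)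
    rw [this]
    simp only [beq_iff_eq, Option.some.injEq, decide_eq_true_eq]
  rw [← e1, ← e2]
  rfl

theorem ConcreteFunctor.certificate_iff [σ.IsRelational] [τ.IsRelational] (x y : List Bool) :
    F.certificate eσ eτ x y ↔ ∃ (A : σ.Structure (Fin (leadTrue (encodePair (x, y)))))
      (A' : τ.Structure (Fin (leadTrue (encodePair (x, y))))),
        encodeStructure eσ A = y ∧ encodeStructure eτ A' = x ∧ ∃ hA : C.Mem A, F.obj A hA = A' := by
  constructor
  · rintro ⟨n, A, hA, rfl, rfl⟩
    rw [leadTrue_encodePair]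
    exact ⟨A, _, rfl, rfl, hA, rfl⟩
  · rintro ⟨A, A', hy, hx, hA, rfl⟩
    exact ⟨_, A, hA, hy, hx⟩

theorem exists_arity_le {L : FirstOrder.Language.{0, 0}} (h : IsFiniteSignature L) :
    ∃ B, ∀ R : Σ k, L.Relations k, R.1 ≤ B := by
  have := h.finite_symbols
  obtain ⟨B, hB⟩ := (Set.finite_range fun R : Σ k, L.Relations k => R.1).bddAbove
  exact ⟨B, fun R => hB ⟨R, rfl⟩⟩

theorem ConcreteFunctor.isPolyTimeRelation_certificate (hσ : IsFiniteSignature σ)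
    (hτ : IsFiniteSignature τ) (hC : C.IsLocal) : IsPolyTimeRelation (F.certificate eσ eτ) := by
  classical
  have := hσ.relational
  have := hτ.relational
  have := hσ.finite_symbols
  have := hτ.finite_symbols
  obtain ⟨N, hN⟩ := F.obj_eq_iff hC
  obtain ⟨Bσ, hBσ⟩ := exists_arity_le hσ
  obtain ⟨Bτ, hBτ⟩ := exists_arity_le hτ
  -- Large enough for the locality test, for the arities of both signatures, and for the exponent 1
  -- of the unary block.
  set B := N + Bσ + Bτ + 1
  have hBσ' : ∀ R : Σ k, σ.Relations k, R.1 ≤ B := fun R => (hBσ R).trans (by omega)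
  have hBτ' : ∀ R : Σ k, τ.Relations k, R.1 ≤ B := fun R => (hBτ R).trans (by omega)
  refine ⟨fun p => decide (F.certificate eσ eτ p.1 p.2), ?_, fun x y => by simp⟩
  refine computableInPolyTime_of_local (pairArity (σ := σ) (τ := τ)) (pairPrefix eσ eτ) B F.Good
    (by rintro (R | R); exacts [hBτ' R, hBσ' R]) ?_ (pairFormat eτ eσ)
    (pairFormat_le eσ eτ (by omega) hBσ' hBτ') _ _ ?_
  · rintro (R | R) a ha
    · exact tablePrefix_le eτ (by omega) hBτ' _ a ha
    · rcases List.mem_append.1 ha with ha | ha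
      · exact tablePrefix_le eτ (by omega) hBτ' _ a ha
      · rcases List.mem_cons.1 ha with rfl | ha
        · exact Nat.zero_le _
        · exact tablePrefix_le eσ (by omega) hBσ' _ a ha
  · rintro ⟨x, y⟩
    rw [decide_eq_true_eq, F.certificate_iff, hasFormat_pairFormat]
    set n := leadTrue (encodePair (x, y))
    have key : ∀ (A : σ.Structure (Fin n)) (A' : τ.Structure (Fin n)),
        encodeStructure eσ A = y → encodeStructure eτ A' = x →
        ((∃ hA : C.Mem A, F.obj A hA = A') ↔ ∀ (m : Fin (B + 1)) (t : List ℕ), t.length = m →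
          t.Pairwise (· < ·) → (∀ x ∈ t, x < n) → F.Good m fun b =>
            (encodePair (x, y))[entryPos n (pairPrefix eσ eτ b.1) fun c => t.getD (b.2 c) 0]? ==
              some (some true)) := by
      rintro A A' hy hx
      rw [hN B (by omega) hBτ' A A', ← hy, ← hx]
      refine forall_congr' fun m => ⟨fun h l hl hpw hb => ?_, fun h t ht => ?_⟩
      · refine (good_iff F eσ eτ A A' l (fun c => ⟨l[(c : ℕ)]'(by omega), hb _ (by simp)⟩)
          fun c => ?_).2 (h _ fun a b hab => ?_)
        · simp [hl]
        · exact List.pairwise_iff_getElem.1 hpw _ _ _ _ hab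
      · refine (good_iff F eσ eτ A A' (List.ofFn fun c => (t c : ℕ)) t fun c => by simp).1
          (h _ (by simp) ?_ ?_)
        · rw [List.pairwise_ofFn]
          exact fun a b hab => ht hab
        · simp [List.mem_ofFn]
    constructor
    · rintro ⟨A, A', hy, hx, h⟩
      exact ⟨⟨⟨A', hx⟩, A, hy⟩, (key A A' hy hx).1 h⟩
    · rintro ⟨⟨⟨A', hx⟩, A, hy⟩, h⟩
      exact ⟨A, A', hy, hx, (key A A' hy hx).2 h⟩

theorem ConcreteFunctor.isCertification_certificate (hσ : IsFiniteSignature σ)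
    (hτ : IsFiniteSignature τ) (hC : C.IsLocal) (hF : F.IsSurjective) :
    IsCertification (F.certificate eσ eτ) (D.language eτ) := by
  refine ⟨F.isPolyTimeRelation_certificate eσ eτ hσ hτ hC,
    -- At `n` this polynomial is the exact length of the encoding of a `σ`-structure on `n`
    -- vertices. It is monotone, and `n` is at most the length of `x`.
    ((tablePrefix eσ r).map (Polynomial.X ^ ·)).sum, fun x => ⟨?_, ?_⟩⟩
  · rintro ⟨n, A', hA', rfl⟩
    obtain ⟨A, hA, rfl⟩ := hF A' hA'
    refine ⟨encodeStructure eσ A, ?_, n, A, hA, rfl, rfl⟩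
    have hn : n ≤ (encodeStructure eτ (F.obj A hA)).length := by
      simp [encodeStructure_eq]
    rw [length_encodeStructure]
    generalize (encodeStructure eτ (F.obj A hA)).length = N at hn
    generalize tablePrefix eσ r = l
    induction l with
    | nil => simp
    | cons a l ih =>
      simp only [List.map_cons, List.sum_cons, Polynomial.eval_add, Polynomial.eval_pow,
        Polynomial.eval_X]
      exact Nat.add_le_add (Nat.pow_le_pow_left hn a) ih
  · rintro ⟨y, -, n, A, hA, -, rfl⟩
    exact ⟨n, _, F.obj_mem A hA, rfl⟩

end Certificates

end PseudoLocal

theorem mainTheorem6 (τ : FirstOrder.Language.{0, 0}) (hτ : PseudoLocal.IsFiniteSignature τ)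
    (s : ℕ) (eτ : Fin s ≃ Σ k, τ.Relations k) (D : PseudoLocal.StructureClass τ) :
    (D.IsPseudoLocal → D.language eτ ∈ PseudoLocal.NP) ∧
    ∀ (σ : FirstOrder.Language.{0, 0}) (_ : PseudoLocal.IsFiniteSignature σ)
      (r : ℕ) (eσ : Fin r ≃ Σ k, σ.Relations k) (C : PseudoLocal.StructureClass σ)
      (F : PseudoLocal.ConcreteFunctor C D), C.IsLocal → F.IsSurjective →
      PseudoLocal.IsCertification (F.certificate eσ eτ) (D.language eτ) := by
  refine ⟨?_, fun σ hσ r eσ C F hC hF => F.isCertification_certificate eσ eτ hσ hτ hC hF⟩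
  rintro ⟨σ, C, F, hσ, hC, hF⟩
  have := hσ.finite_symbols
  obtain ⟨r, ⟨e⟩⟩ := Finite.exists_equiv_fin (Σ k, σ.Relations k)
  exact ⟨_, F.isCertification_certificate e.symm eτ hσ hτ hC hF⟩
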